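/- Let $[n]$ be a set of agents and $[m]$ a set of divisible items. Every agent $i$ has a binary additive valuation $v_i$: $v_i(S)=\sum_{o\in S}v_i(\{o\})$ for all $S\subseteq[m]$, and $v_i(\{o\})\in\{0,1\}$. An allocation is a matrix $x\in\mathbb R_{\ge 0}^{n\times m}$ with $\sum_i x_{io}\le 1$ for every item $o$, where $x_{io}$ is the fraction of $o$ given to $i$. Only allocations are considered that are clean ($x_{io}>0$ implies $v_i(\{o\})=1$) and that maximize $\sum_{i,o}v_i(\{o\})x_{io}$ over all allocations. The profile of such an allocation $x$ is $\mathbf p(x)=(h_1,\dots,h_n)$ with $h_i=\sum_o x_{io}$. A criterion is a real-valued function $f$ on profiles (lower scores are better) that is symmetric, i.e. profiles that are permutations of each other have the same score. It is strongly Pigou-Dalton (SPD) if $f(\mathbf q)<f(\mathbf p)$ for all profiles $\mathbf p,\mathbf q$ such that for some agents $j,k$ we have $p_j<p_k$, $q_j,q_k\in(p_j,p_k)$, and $q_i=p_i$ for all $i\ne j,k$. An allocation $x$ is optimal under $f$ if $f(\mathbf p(x))\le f(\mathbf p(y))$ for every allocation $y$ under consideration. A transfer of size $\Delta>0$ from $u$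 to $w$ in $x$ consists of distinct agents $u=i_1,i_2,\dots,i_k=w$ ($k\ge2$) and items $o_1,\dots,o_{k-1}$ such that $x_{i_jo_j}\ge\Delta$ and $v_{i_{j+1}}(\{o_j\})=1$ for $1\le j<k$ (so a fraction $\Delta$ of $o_j$ can be moved from $i_j$ to $i_{j+1}$ for every $j$). It is narrowing if $h_u-\Delta\ge h_w+\Delta$. An allocation $x$ is stable if it admits no narrowing transfer. 1. For every symmetric SPD criterion $f$, the set of allocations that are optimal under $f$ is exactly the set of stable allocations. 2. A stable allocation can be found in polynomial time: there are a fixed program of a random access machine (finitely many variables and two-dimensional arrays of natural numbers; constants, addition, truncated subtraction, zero tests for branches and loops, assignments and array accesses, each at unit cost) and a polynomial $P$ such that, for all $n$, $m$ and all binary additive valuations $v_1,\dots,v_n$, given as input $n$, $m$ and the $0/1$ matrix $(v_i(\{o\}))_{i,o}$, the program halts after at most $P(n+m)$ steps and outputs a stable allocation, whose entries are rational numbers written as numerator and denominator. -/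

import Mathlib

/-! ## Divisible items and binary additive valuations

Agents are `Fin n`, items are `Fin m`; `v i S` is the value of the bundle `S` for agent `i`. -/

namespace FairDiv

/-- `v` is a binary additive (0/1-additive) valuation: a bundle is worth the sum of the values of
its items, and each single item is worth `0` or `1`. -/
structure IsBinaryAdditive {m : ℕ} (v : Finset (Fin m) → ℝ) : Prop where
  zero_or_one : ∀ o, v {o} = 0 ∨ v {o} = 1
  additive : ∀ S, v S = ∑ o ∈ S, v {o}

/-- An allocation of divisible items: `x i o` is the fraction of item `o` given to agent `i`.
Items need not be given away completely. -/
structure IsAllocation {n m : ℕ} (x : Fin n → Fin m → ℝ) : Prop where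
  nonneg : ∀ i o, 0 ≤ x i o
  sum_le_one : ∀ o, ∑ i, x i o ≤ 1

/-- The value for agent `i` of the fractional bundle that `x` gives to her (`v` additive). -/
def utility {n m : ℕ} (v : Fin n → Finset (Fin m) → ℝ) (x : Fin n → Fin m → ℝ) (i : Fin n) : ℝ :=
  ∑ o, v i {o} * x i o

/-- Utilitarian social welfare. -/
def usw {n m : ℕ} (v : Fin n → Finset (Fin m) → ℝ) (x : Fin n → Fin m → ℝ) : ℝ :=
  ∑ i, utility v x i

/-- The allocations under consideration: those that are clean (nobody holds a part of an item which
is worthless to her) and maximize utilitarian social welfare among all allocations. -/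
structure IsAdmissible {n m : ℕ} (v : Fin n → Finset (Fin m) → ℝ) (x : Fin n → Fin m → ℝ) :
    Prop where
  isAllocation : IsAllocation x
  clean : ∀ i o, 0 < x i o → v i {o} ≠ 0
  maxUSW : ∀ y : Fin n → Fin m → ℝ, IsAllocation y → usw v y ≤ usw v x

/-- The profile `(h₁, …, hₙ)` of an allocation: the amount of items that each agent receives. -/
def profile {n m : ℕ} (x : Fin n → Fin m → ℝ) (i : Fin n) : ℝ :=
  ∑ o, x i o

/-- The set of all profiles of admissible allocations. -/
def profiles {n m : ℕ} (v : Fin n → Finset (Fin m) → ℝ) : Set (Fin n → ℝ) :=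
  {p | ∃ x : Fin n → Fin m → ℝ, IsAdmissible v x ∧ profile x = p}

/-! ### Criteria -/

/-- A criterion `f`, viewed as a function on the set `P` of profiles, is symmetric: permuting a
profile does not change its score. -/
def IsSymmetricOn {n : ℕ} (P : Set (Fin n → ℝ)) (f : (Fin n → ℝ) → ℝ) : Prop :=
  ∀ p ∈ P, ∀ σ : Equiv.Perm (Fin n), p ∘ σ ∈ P → f (p ∘ σ) = f p

/-- The profile `q` is more balanced than `p`. -/
def MoreBalanced {n : ℕ} (q p : Fin n → ℝ) : Prop :=
  ∃ j k : Fin n, p j < p k ∧ q j ∈ Set.Ioo (p j) (p k) ∧ q k ∈ Set.Ioo (p j) (p k) ∧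
    ∀ i, i ≠ j → i ≠ k → q i = p i

/-- A criterion `f`, viewed as a function on the set `P` of profiles, is strongly Pigou-Dalton. -/
def IsSPDOn {n : ℕ} (P : Set (Fin n → ℝ)) (f : (Fin n → ℝ) → ℝ) : Prop :=
  ∀ p ∈ P, ∀ q ∈ P, MoreBalanced q p → f q < f p

/-- The optimal allocations under the criterion `f` (lower scores are better). -/
def optimalAllocations {n m : ℕ} (v : Fin n → Finset (Fin m) → ℝ) (f : (Fin n → ℝ) → ℝ) :
    Set (Fin n → Fin m → ℝ) :=
  {x | IsAdmissible v x ∧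
    ∀ y : Fin n → Fin m → ℝ, IsAdmissible v y → f (profile x) ≤ f (profile y)}

/-! ### Stable allocations -/

/-- A transfer from `u` to `w` of size `Δ` in the allocation `x`: a simple path
`u = agent 0, …, agent (len + 1) = w` with at least two vertices, such that, for every `j`, agent
`j` holds at least a fraction `Δ` of item `item j`, which has value `1` for the next agent (so that
this fraction can be handed on to the next agent). -/
structure Transfer {n m : ℕ} (v : Fin n → Finset (Fin m) → ℝ) (x : Fin n → Fin m → ℝ)
    (u w : Fin n) (Δ : ℝ) where
  len : ℕ
  agent : Fin (len + 2) → Fin n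
  item : Fin (len + 1) → Fin m
  simple : Function.Injective agent
  first : agent 0 = u
  last : agent (Fin.last (len + 1)) = w
  pos : 0 < Δ
  holds : ∀ j : Fin (len + 1), Δ ≤ x (agent j.castSucc) (item j)
  wanted : ∀ j : Fin (len + 1), v (agent j.succ) {item j} = 1

/-- The allocation `x` admits a narrowing transfer. -/
def AdmitsNarrowingTransfer {n m : ℕ} (v : Fin n → Finset (Fin m) → ℝ)
    (x : Fin n → Fin m → ℝ) : Prop :=
  ∃ (u w : Fin n) (Δ : ℝ), Nonempty (Transfer v x u w Δ) ∧
    profile x w + Δ ≤ profile x u - Δ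

/-- The stable allocations: the admissible ones without a narrowing transfer. -/
def stableAllocations {n m : ℕ} (v : Fin n → Finset (Fin m) → ℝ) :
    Set (Fin n → Fin m → ℝ) :=
  {x | IsAdmissible v x ∧ ¬ AdmitsNarrowingTransfer v x}

/-! ### A random access machine with a step count

A program works on finitely many variables and finitely many two-dimensional arrays (those whose
names it mentions), all holding natural numbers. The arithmetic operations are addition and
truncated subtraction; each operation and each memory access costs one step. As there is no
multiplication, a run of `t` steps only produces numbers of at most `O(t)` more bits than its
input, so that polynomial time has its usual meaning. -/

/-- The contents of the memory: the variables and the two-dimensional arrays. -/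
structure Store where
  var : ℕ → ℕ
  arr : ℕ → ℕ → ℕ → ℕ

inductive Expr where
  | const (c : ℕ)
  | var (a : ℕ)
  | read (A : ℕ) (i j : Expr)
  | add (e₁ e₂ : Expr)
  | sub (e₁ e₂ : Expr)

/-- The value of an expression. -/
def Expr.eval (s : Store) : Expr → ℕ
  | .const c => c
  | .var a => s.var a
  | .read A i j => s.arr A (i.eval s) (j.eval s)
  | .add e₁ e₂ => e₁.eval s + e₂.eval s
  | .sub e₁ e₂ => e₁.eval s - e₂.eval s

/-- The number of steps needed to evaluate an expression. -/
def Expr.cost : Expr → ℕ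
  | .const _ => 1
  | .var _ => 1
  | .read _ i j => i.cost + j.cost + 1
  | .add e₁ e₂ => e₁.cost + e₂.cost + 1
  | .sub e₁ e₂ => e₁.cost + e₂.cost + 1

/-- Programs; a test `e` succeeds if the value of `e` is not `0`. -/
inductive Program where
  | skip
  | assign (a : ℕ) (e : Expr)
  | write (A : ℕ) (i j e : Expr)
  | seq (c₁ c₂ : Program)
  | branch (e : Expr) (c₁ c₂ : Program)
  | loop (e : Expr) (c : Program)

def Store.setVar (s : Store) (a k : ℕ) : Store :=
  { s with var := Function.update s.var a k }

def Store.setArr (s : Store) (A i j k : ℕ) : Store :=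
  ⟨s.var, Function.update s.arr A
    (Function.update (s.arr A) i (Function.update (s.arr A i) j k))⟩

/-- `Runs c s s' t`: started in the store `s`, the program `c` halts in the store `s'` after exactly
`t` steps. -/
inductive Runs : Program → Store → Store → ℕ → Prop
  | skip (s : Store) : Runs .skip s s 1
  | assign (s : Store) (a : ℕ) (e : Expr) :
      Runs (.assign a e) s (s.setVar a (e.eval s)) (e.cost + 1)
  | write (s : Store) (A : ℕ) (i j e : Expr) :
      Runs (.write A i j e) s (s.setArr A (i.eval s) (j.eval s) (e.eval s))
        (i.cost + j.cost + e.cost + 1)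
  | seq {c₁ c₂ : Program} {s₁ s₂ s₃ : Store} {t₁ t₂ : ℕ} :
      Runs c₁ s₁ s₂ t₁ → Runs c₂ s₂ s₃ t₂ → Runs (.seq c₁ c₂) s₁ s₃ (t₁ + t₂)
  | branch_true {e : Expr} {c₁ c₂ : Program} {s s' : Store} {t : ℕ} :
      e.eval s ≠ 0 → Runs c₁ s s' t → Runs (.branch e c₁ c₂) s s' (e.cost + t + 1)
  | branch_false {e : Expr} {c₁ c₂ : Program} {s s' : Store} {t : ℕ} :
      e.eval s = 0 → Runs c₂ s s' t → Runs (.branch e c₁ c₂) s s' (e.cost + t + 1)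
  | loop_stop {e : Expr} {c : Program} {s : Store} :
      e.eval s = 0 → Runs (.loop e c) s s (e.cost + 1)
  | loop_step {e : Expr} {c : Program} {s₁ s₂ s₃ : Store} {t₁ t₂ : ℕ} :
      e.eval s₁ ≠ 0 → Runs c s₁ s₂ t₁ → Runs (.loop e c) s₂ s₃ t₂ →
        Runs (.loop e c) s₁ s₃ (e.cost + t₁ + t₂ + 1)

/-- Programs are deterministic: the final store and the number of steps are determined. -/
theorem Runs.det {c : Program} {s s₁ s₂ : Store} {t₁ t₂ : ℕ} (h₁ : Runs c s s₁ t₁)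
    (h₂ : Runs c s s₂ t₂) : s₁ = s₂ ∧ t₁ = t₂ := by
  induction h₁ generalizing s₂ t₂ with
  | skip => cases h₂; exact ⟨rfl, rfl⟩
  | assign => cases h₂; exact ⟨rfl, rfl⟩
  | write => cases h₂; exact ⟨rfl, rfl⟩
  | seq _ _ ih₁ ih₂ =>
    cases h₂ with
    | seq k₁ k₂ =>
      obtain ⟨rfl, rfl⟩ := ih₁ k₁
      obtain ⟨rfl, rfl⟩ := ih₂ k₂
      exact ⟨rfl, rfl⟩
  | branch_true h _ ih =>
    cases h₂ with
    | branch_true _ k => obtain ⟨rfl, rfl⟩ := ih k; exact ⟨rfl, rfl⟩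
    | branch_false h' _ => exact absurd h' h
  | branch_false h _ ih =>
    cases h₂ with
    | branch_true h' _ => exact absurd h h'
    | branch_false _ k => obtain ⟨rfl, rfl⟩ := ih k; exact ⟨rfl, rfl⟩
  | loop_stop h =>
    cases h₂ with
    | loop_stop _ => exact ⟨rfl, rfl⟩
    | loop_step h' _ _ => exact absurd h h'
  | loop_step h _ _ ih₁ ih₂ =>
    cases h₂ with
    | loop_stop h' => exact absurd h' h
    | loop_step _ k₁ k₂ =>
      obtain ⟨rfl, rfl⟩ := ih₁ k₁
      obtain ⟨rfl, rfl⟩ := ih₂ k₂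
      exact ⟨rfl, rfl⟩

open Classical in
/-- The initial store on input `v`: variable `0` holds the number `n` of agents, variable `1` the
number `m` of items, array `0` the `n × m` matrix of the values of the single items; all other
variables and cells hold `0`. -/
noncomputable def inputStore {n m : ℕ} (v : Fin n → Finset (Fin m) → ℝ) : Store where
  var := fun a => if a = 0 then n else if a = 1 then m else 0
  arr := fun A i o =>
    if A = 0 ∧ ∃ (hi : i < n) (ho : o < m), v ⟨i, hi⟩ {⟨o, ho⟩} = 1 then 1 else 0

/-- The store `s` holds the allocation `x` as output: the fractions `x i o` are rational numbers,
with numerators in array `1` and positive denominators in array `2`. -/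
def IsOutput {n m : ℕ} (s : Store) (x : Fin n → Fin m → ℝ) : Prop :=
  ∀ (i : Fin n) (o : Fin m), 0 < s.arr 2 i o ∧ x i o = (s.arr 1 i o : ℝ) / (s.arr 2 i o : ℝ)

end FairDiv

/-! Call `w` reachable from `u` in an allocation if items can be handed on along a path from `u` to
`w`. Transfers may be arbitrarily small, so an allocation is stable exactly if loads never decrease
along reachability (`admitsNarrowingTransfer_iff`).

Optimal allocations are stable because a small transfer from a richer to a poorer agent yields a
more balanced profile (`optimalAllocations_subset`). Conversely, let `x` be stable and `y`
admissible with a different profile. The matrix `y - x` has zero column sums, so from an agent `u`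
with more in `y` than in `x` a path that respects the signs of `y - x` leads to an agent `w` with
less in `y`. Reversed, this is a path in `x`, and stability gives `h_w(y) < h_w(x) ≤ h_u(x) <
h_u(y)`. Moving `y` towards `x` along the path is thus balancing and lowers the score; taking the
largest step without overshooting kills a coordinate of the difference, so the process ends at the
profile of `x` (`le_of_stable`).

The algorithm works with `D` indivisible units per item and moves single units to agents whose load
is smaller by two or more, until loads drop by at most one unit along paths. If `n!` divides `D`,
such an allocation is already stable: a set closed under arcs holds whole items only, so a
difference of two closed sets on which both loads `c - 1` and `c` occur, and no others, would have a
non-integral average load, although the average is an integer (`IsIntegral.spreadLE_zero`).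

Starting directly with `D = n!` could require too many moves. Instead `D` runs through `1!, 2!, …,
n!`. Refining units by the factor `k + 1` turns a spread of one into a spread of at most `k + 1`,
and an allocation of spread `k` has a sum of squared loads within `n * k ^ 2` of the minimum,
independently of `D` (`IsIntegral.sqLoad_le`). As every effective sweep lowers this sum,
polynomially many sweeps suffice in each phase. The program logic of `Ensures` yields correctness
and the time bound together. -/

namespace FairDiv

/-! ### Exchanges along directed paths -/

/-- `i'` can take over from `i` a part of some item `o`. -/
def Arc {α β : Type*} (P N : α → β → Prop) (i i' : α) : Prop := ∃ o, P i o ∧ N i' o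

/-- `w` is reachable from `u` along arcs. -/
abbrev Reach {α β : Type*} (P N : α → β → Prop) : α → α → Prop :=
  Relation.ReflTransGen (Arc P N)

/-- Along a path from `u` to `w`, one unit can be moved from `u` to `w`. -/
theorem Reach.exists_exchange {α β : Type*} [Fintype α] [Fintype β] [DecidableEq α]
    [DecidableEq β] {P N : α → β → Prop} {u w : α} (h : Reach P N u w) :
    ∃ E : α → β → ℝ, (∀ i o, 0 < E i o → P i o) ∧ (∀ i o, E i o < 0 → N i o) ∧
      (∀ o, ∑ i, E i o = 0) ∧
      ∀ i, ∑ o, E i o = (if i = u then 1 else 0) - (if i = w then 1 else 0) := by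
  induction h with
  | refl => exact ⟨fun _ _ => 0, by simp, by simp, by simp, by simp⟩
  | @tail b c _ hbc ih =>
    obtain ⟨E, hP, hN, hc, hr⟩ := ih
    obtain ⟨o, hPo, hNo⟩ := hbc
    refine ⟨fun i o' => E i o' + ((if i = b ∧ o' = o then 1 else 0)
      - (if i = c ∧ o' = o then 1 else 0)), ?_, ?_, ?_, ?_⟩
    · intro i o' h
      by_cases hb : i = b ∧ o' = o
      · rw [hb.1, hb.2]; exact hPo
      · apply hP
        simp only [if_neg hb] at h
        split_ifs at h <;> linarith
    · intro i o' h
      by_cases hb : i = c ∧ o' = o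
      · rw [hb.1, hb.2]; exact hNo
      · apply hN
        simp only [if_neg hb] at h
        split_ifs at h <;> linarith
    · intro o'
      simp only [Finset.sum_add_distrib, hc, Finset.sum_sub_distrib, ite_and]
      simp
    · intro i
      simp only [Finset.sum_add_distrib, hr, Finset.sum_sub_distrib]
      have (a : α) : ∑ x, (if i = a ∧ x = o then (1 : ℝ) else 0) = if i = a then 1 else 0 := by
        by_cases h : i = a <;> simp [h]
      rw [this, this]
      ring

/-- A shortest path visits no vertex twice. -/
theorem exists_injOn_path {α : Type*} {R : α → α → Prop} {u w : α}
    (h : Relation.ReflTransGen R u w) :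
    ∃ (k : ℕ) (a : ℕ → α), a 0 = u ∧ a k = w ∧ (∀ j < k, R (a j) (a (j + 1))) ∧
      Set.InjOn a (Set.Iic k) := by
  classical
  have hex : ∃ k, ∃ a : ℕ → α, a 0 = u ∧ a k = w ∧ ∀ j < k, R (a j) (a (j + 1)) := by
    induction h with
    | refl => exact ⟨0, fun _ => u, rfl, rfl, by simp⟩
    | @tail b c _ hbc ih =>
      obtain ⟨k, a, h0, hk, hR⟩ := ih
      refine ⟨k + 1, fun j => if j ≤ k then a j else c, by simp [h0], by simp, ?_⟩
      intro j hj
      rcases Nat.lt_succ_iff_lt_or_eq.1 hj with h | rfl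
      · simpa [h.le, Nat.succ_le_of_lt h] using hR j h
      · simpa [hk] using hbc
  obtain ⟨a, h0, hk, hR⟩ := Nat.find_spec hex
  refine ⟨Nat.find hex, a, h0, hk, hR, ?_⟩
  -- A repeated vertex at positions `i < j` would allow the walk to skip `j - i` steps, against the
  -- minimality of `Nat.find hex`.
  have key : ∀ i j, i < j → j ≤ Nat.find hex → a i ≠ a j := by
    intro i j hij hjk heq
    refine Nat.find_min hex (m := Nat.find hex - (j - i)) (by omega)
      ⟨fun t => if t ≤ i then a t else a (t + (j - i)), by simp [h0], ?_, ?_⟩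
    · by_cases h : Nat.find hex - (j - i) ≤ i
      · have h1 : Nat.find hex = j := by omega
        have h2 : Nat.find hex - (j - i) = i := by omega
        simp only [h2, le_refl, if_true]
        rw [heq, ← h1, hk]
      · simp only [h, if_false]
        rw [Nat.sub_add_cancel (by omega), hk]
    · intro t ht
      rcases lt_trichotomy t i with h | rfl | h
      · simpa [h.le, Nat.succ_le_of_lt h] using hR t (by omega)
      · have := hR j (by omega)
        simp only [le_refl, if_true, Nat.not_succ_le_self, if_false]
        rw [heq]
        rwa [show t + 1 + (j - t) = j + 1 by omega]
      · have := hR (t + (j - i)) (by omega)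
        simp only [h.not_ge, show ¬ t + 1 ≤ i by omega, if_false]
        rwa [show t + 1 + (j - i) = t + (j - i) + 1 by omega]
  intro i hi j hj hij
  rcases lt_trichotomy i j with h | h | h
  · exact absurd hij (key i j h hj)
  · exact h
  · exact absurd hij.symm (key j i h hi)

/-- A matrix whose columns sum to zero and which has a positive row sum admits a sign-conformal
path to a row with a negative sum. -/
theorem exists_reach_neg {α β : Type*} [Fintype α] [Fintype β] {z : α → β → ℝ}
    (hz : ∀ o, ∑ i, z i o = 0) {u : α} (hu : 0 < ∑ o, z u o) :
    ∃ w, Reach (fun i o => 0 < z i o) (fun i o => z i o < 0) u w ∧ ∑ o, z w o < 0 := by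
  classical
  by_contra! hcon
  -- Rows in `R` sum to something positive if none of them is negative. But in a column with a
  -- positive entry in `R`, every negative entry lies in `R` too, so the part outside `R` is
  -- nonnegative and the part inside is at most `0`; a column without such an entry contributes at
  -- most `0` anyway.
  set R : Finset α :=
    Finset.univ.filter (Reach (fun i o => 0 < z i o) (fun i o => z i o < 0) u) with hR
  have h1 : 0 < ∑ i ∈ R, ∑ o, z i o := by
    refine Finset.sum_pos' (fun i hi => hcon i (Finset.mem_filter.1 hi).2) ⟨u, ?_, hu⟩
    exact Finset.mem_filter.2 ⟨Finset.mem_univ _, Relation.ReflTransGen.refl⟩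
  rw [Finset.sum_comm] at h1
  refine h1.not_ge (Finset.sum_nonpos fun o _ => ?_)
  by_cases hpos : ∃ i ∈ R, 0 < z i o
  · obtain ⟨i, hi, hio⟩ := hpos
    have h2 : 0 ≤ ∑ i ∈ Rᶜ, z i o := by
      refine Finset.sum_nonneg fun j hj => ?_
      by_contra! hneg
      refine (Finset.mem_compl.1 hj) (Finset.mem_filter.2 ⟨Finset.mem_univ _, ?_⟩)
      exact (Finset.mem_filter.1 hi).2.tail ⟨o, hio, hneg⟩
    have h3 := Finset.sum_add_sum_compl R fun i => z i o
    rw [hz o] at h3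
    linarith
  · push Not at hpos
    exact Finset.sum_nonpos hpos

/-- The largest step within finitely many constraints `δ * a c ≤ b c`; one of them is tight. -/
theorem exists_max_step {γ : Type*} [Finite γ] {a b : γ → ℝ} (hab : ∀ c, 0 < a c → 0 < b c)
    (ha : ∃ c, 0 < a c) :
    ∃ δ > 0, (∀ c, 0 < a c → δ * a c ≤ b c) ∧ ∃ c, 0 < a c ∧ δ * a c = b c := by
  obtain ⟨c, hc, hmin⟩ := Set.exists_min_image {c | 0 < a c} (fun c => b c / a c)
    (Set.toFinite _) ha
  refine ⟨b c / a c, div_pos (hab c hc) hc, fun d hd => ?_, c, hc, ?_⟩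
  · exact (le_div_iff₀ hd).1 (hmin d hd)
  · exact div_mul_cancel₀ _ (ne_of_gt hc)

/-- Moving from `Z` in a sign-conformal direction, until a further coordinate vanishes. -/
theorem exists_conformal_step {γ : Type*} [Fintype γ] {Z E : γ → ℝ}
    (hpos : ∀ c, 0 < E c → 0 < Z c) (hneg : ∀ c, E c < 0 → Z c < 0) (hE : ∃ c, E c ≠ 0) :
    ∃ δ > 0, (∀ c, 0 ≤ Z c → 0 ≤ Z c - δ * E c) ∧ (∀ c, Z c ≤ 0 → Z c - δ * E c ≤ 0) ∧
      (Finset.univ.filter fun c => Z c - δ * E c ≠ 0).card <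
        (Finset.univ.filter fun c => Z c ≠ 0).card := by
  -- Signs of `E` and `Z` agree where `E` is nonzero, so it suffices to compare absolute values. The
  -- tight coordinate becomes zero, and zeros of `Z` stay zero since `E` vanishes there.
  obtain ⟨δ, hδ, hle, c, hc, hceq⟩ := exists_max_step (a := fun c => |E c|) (b := fun c => |Z c|)
    (fun c hc => by
      rcases lt_or_gt_of_ne (abs_pos.1 hc) with h | h
      · exact abs_pos.2 (hneg c h).ne
      · exact abs_pos.2 (hpos c h).ne')
    (hE.imp fun c => abs_pos.2)
  have hsign : ∀ c, (0 ≤ Z c → 0 ≤ E c) ∧ (Z c ≤ 0 → E c ≤ 0) := fun c =>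
    ⟨fun h => not_lt.1 fun h' => (hneg c h').not_ge h,
     fun h => not_lt.1 fun h' => (hpos c h').not_ge h⟩
  have hle' : ∀ c, δ * |E c| ≤ |Z c| := fun c => by
    rcases (abs_nonneg (E c)).eq_or_lt with h | h
    · rw [← h, mul_zero]; exact abs_nonneg _
    · exact hle c h
  refine ⟨δ, hδ, fun c h => ?_, fun c h => ?_, ?_⟩
  · have := hle' c
    rw [abs_of_nonneg h, abs_of_nonneg ((hsign c).1 h)] at this
    linarith
  · have := hle' c
    rw [abs_of_nonpos h, abs_of_nonpos ((hsign c).2 h)] at this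
    linarith
  · refine Finset.card_lt_card (Finset.ssubset_iff_of_subset ?_ |>.2 ⟨c, ?_, ?_⟩)
    · intro d hd
      simp only [Finset.mem_filter, Finset.mem_univ, true_and] at hd ⊢
      intro h
      have := hle' d
      rw [h, abs_zero] at this
      have h2 : |E d| = 0 := by
        have := abs_nonneg (E d); nlinarith
      apply hd
      rw [h, abs_eq_zero.1 h2]; ring
    · simp only [Finset.mem_filter, Finset.mem_univ, true_and]
      intro h
      rw [h, abs_zero] at hceq
      exact (mul_pos hδ hc).ne' hceq
    · simp only [Finset.mem_filter, Finset.mem_univ, true_and, not_not]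
      rcases lt_or_gt_of_ne (abs_pos.1 hc) with h | h
      · simp only [abs_of_neg h, abs_of_neg (hneg c h)] at hceq
        linarith
      · simp only [abs_of_pos h, abs_of_pos (hpos c h)] at hceq
        linarith

/-! ### Admissible and stable allocations -/

section Admissible

variable {n m : ℕ} {v : Fin n → Finset (Fin m) → ℝ}

theorem usw_eq {x : Fin n → Fin m → ℝ}
    (hnn : ∀ i o, 0 ≤ x i o) (hcl : ∀ i o, 0 < x i o → v i {o} = 1) :
    usw v x = ∑ o, ∑ i, x i o := by
  rw [Finset.sum_comm]
  refine Finset.sum_congr rfl fun i _ => Finset.sum_congr rfl fun o _ => ?_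
  rcases (hnn i o).eq_or_lt with h | h
  · rw [← h, mul_zero]
  · rw [hcl i o h, one_mul]

open Classical in
theorem sum_value_mul_le (hv : ∀ i, IsBinaryAdditive (v i)) {x : Fin n → Fin m → ℝ}
    (hx : IsAllocation x) (o : Fin m) :
    ∑ i, v i {o} * x i o ≤ if ∃ i, v i {o} = 1 then 1 else 0 := by
  split_ifs with h
  · refine (Finset.sum_le_sum fun i _ => ?_).trans (hx.sum_le_one o)
    rcases (hv i).zero_or_one o with h | h
    · rw [h, zero_mul]; exact hx.nonneg i o
    · rw [h, one_mul]
  · push Not at h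
    refine (Finset.sum_eq_zero fun i _ => ?_).le
    rw [((hv i).zero_or_one o).resolve_right (h i), zero_mul]

/-- The admissible allocations are the clean ones that give away every valuable item. -/
theorem isAdmissible_iff (hv : ∀ i, IsBinaryAdditive (v i)) {x : Fin n → Fin m → ℝ} :
    IsAdmissible v x ↔ (∀ i o, 0 ≤ x i o) ∧ (∀ i o, 0 < x i o → v i {o} = 1) ∧
      ∀ o, (∃ i, v i {o} = 1) → ∑ i, x i o = 1 := by
  classical
  constructor
  · intro h
    have hcl : ∀ i o, 0 < x i o → v i {o} = 1 := fun i o hio =>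
      ((hv i).zero_or_one o).resolve_left (h.clean i o hio)
    refine ⟨h.isAllocation.nonneg, hcl, ?_⟩
    -- Giving each valuable item to one agent who wants it attains the upper bound of
    -- `sum_value_mul_le` for every item, so a maximizer must attain it item by item.
    have hg : ∀ o, ∃ g : Fin n → ℝ, (∀ i, 0 ≤ g i) ∧ ∑ i, g i ≤ 1 ∧
        ∑ i, v i {o} * g i = if ∃ i, v i {o} = 1 then 1 else 0 := by
      intro o
      split_ifs with ho
      · obtain ⟨i, hi⟩ := ho
        refine ⟨Pi.single i 1, fun j => ?_, ?_, ?_⟩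
        · by_cases hj : j = i
          · rw [hj, Pi.single_eq_same]; exact zero_le_one
          · rw [Pi.single_eq_of_ne hj]
        · simp
        · rw [Finset.sum_eq_single i (fun j _ hj => by rw [Pi.single_eq_of_ne hj, mul_zero])
            (by simp), Pi.single_eq_same, hi, mul_one]
      · exact ⟨0, by simp, by simp, by simp⟩
    choose g hg0 hg1 hg2 using hg
    have hle := h.maxUSW (fun i o => g o i) ⟨fun i o => hg0 o i, hg1⟩
    have heq (y : Fin n → Fin m → ℝ) : usw v y = ∑ o, ∑ i, v i {o} * y i o := Finset.sum_comm
    rw [heq, heq] at hle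
    simp only [hg2] at hle
    have hterm := fun o => sum_value_mul_le hv h.isAllocation o
    have h2 := (Finset.sum_eq_sum_iff_of_le fun o (_ : o ∈ Finset.univ) => hterm o).1
      (le_antisymm (Finset.sum_le_sum fun o _ => hterm o) hle)
    intro o ho
    have h3 := h2 o (Finset.mem_univ _)
    rw [if_pos ho] at h3
    rw [← h3]
    refine Finset.sum_congr rfl fun i _ => ?_
    rcases (h.isAllocation.nonneg i o).eq_or_lt with h | h
    · rw [← h, mul_zero]
    · rw [hcl i o h, one_mul]
  · rintro ⟨hnn, hcl, hfull⟩
    have hcol : ∀ o, ∑ i, x i o = if ∃ i, v i {o} = 1 then 1 else 0 := by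
      intro o
      split_ifs with ho
      · exact hfull o ho
      · push Not at ho
        exact Finset.sum_eq_zero fun i _ =>
          ((hnn i o).eq_or_lt.resolve_right fun h => ho i (hcl i o h)).symm
    refine ⟨⟨hnn, fun o => ?_⟩, fun i o h => by rw [hcl i o h]; exact one_ne_zero, fun y hy => ?_⟩
    · rw [hcol]; split_ifs <;> norm_num
    · rw [usw_eq hnn hcl]
      calc usw v y = ∑ o, ∑ i, v i {o} * y i o := Finset.sum_comm
        _ ≤ ∑ o, ∑ i, x i o := Finset.sum_le_sum fun o _ => by
          rw [hcol]; exact sum_value_mul_le hv hy o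

/-- This makes the difference of two admissible allocations a matrix with zero column sums, as
`exists_reach_neg` needs. -/
theorem IsAdmissible.col_sum_eq (hv : ∀ i, IsBinaryAdditive (v i)) {x y : Fin n → Fin m → ℝ}
    (hx : IsAdmissible v x) (hy : IsAdmissible v y) (o : Fin m) :
    ∑ i, x i o = ∑ i, y i o := by
  obtain ⟨hx0, hx1, hx2⟩ := (isAdmissible_iff hv).1 hx
  obtain ⟨hy0, hy1, hy2⟩ := (isAdmissible_iff hv).1 hy
  by_cases ho : ∃ i, v i {o} = 1
  · rw [hx2 o ho, hy2 o ho]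
  · push Not at ho
    refine Finset.sum_congr rfl fun i _ => ?_
    rw [← (hx0 i o).eq_or_lt.resolve_right fun h => ho i (hx1 i o h),
      ← (hy0 i o).eq_or_lt.resolve_right fun h => ho i (hy1 i o h)]

/-- `w` is reachable from `u` by moving items along the arcs of the allocation `x`. -/
abbrev Reaches (v : Fin n → Finset (Fin m) → ℝ) (x : Fin n → Fin m → ℝ) : Fin n → Fin n → Prop :=
  Reach (fun i o => 0 < x i o) (fun i o => v i {o} = 1)

theorem Transfer.reaches {x : Fin n → Fin m → ℝ} {u w : Fin n} {Δ : ℝ}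
    (T : Transfer v x u w Δ) : Reaches v x u w := by
  have h : ∀ j : Fin (T.len + 2), Reaches v x u (T.agent j) := by
    intro j
    induction j using Fin.induction with
    | zero => rw [T.first]
    | succ j ih => exact ih.tail ⟨T.item j, T.pos.trans_le (T.holds j), T.wanted j⟩
  have := h (Fin.last _)
  rwa [T.last] at this

theorem Reaches.exists_transfer {x : Fin n → Fin m → ℝ} {u w : Fin n} (h : Reaches v x u w)
    (huw : u ≠ w) {ε : ℝ} (hε : 0 < ε) : ∃ Δ ≤ ε, Nonempty (Transfer v x u w Δ) := by
  obtain ⟨k, a, h0, hk, hR, hinj⟩ := exists_injOn_path h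
  obtain ⟨l, rfl⟩ : ∃ l, k = l + 1 := by
    refine Nat.exists_eq_succ_of_ne_zero ?_
    rintro rfl
    exact huw (h0.symm.trans hk)
  choose o hpos hw using fun j : Fin (l + 1) => hR j j.2
  -- The index `none` bounds the size by `ε`, the others by the fractions held along the path.
  obtain ⟨δ, hδ, hle, -⟩ := exists_max_step (γ := Option (Fin (l + 1))) (a := fun _ => 1)
    (b := fun c => c.elim ε fun j => x (a j) (o j))
    (by rintro (_ | c) _; exacts [hε, hpos c]) ⟨none, one_pos⟩
  refine ⟨δ, by simpa using hle none one_pos, ⟨⟨l, fun j => a j, o, ?_, h0, hk, hδ, ?_, hw⟩⟩⟩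
  · intro i j hij
    exact Fin.ext (hinj (Set.mem_Iic.2 (Nat.lt_succ_iff.1 i.2))
      (Set.mem_Iic.2 (Nat.lt_succ_iff.1 j.2)) hij)
  · intro j
    simpa using hle (some j) one_pos

/-- Sizes may be as small as desired: half the gap between the loads is an admissible upper bound.
Stability thereby becomes a statement on reachability alone. -/
theorem admitsNarrowingTransfer_iff {x : Fin n → Fin m → ℝ} :
    AdmitsNarrowingTransfer v x ↔ ∃ u w, Reaches v x u w ∧ profile x w < profile x u := by
  constructor
  · rintro ⟨u, w, Δ, ⟨T⟩, h⟩
    exact ⟨u, w, T.reaches, by linarith [T.pos]⟩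
  · rintro ⟨u, w, h, hlt⟩
    obtain ⟨Δ, hΔ, T⟩ := Reaches.exists_transfer h (fun h => hlt.ne (by rw [h]))
      (half_pos (sub_pos.2 hlt))
    exact ⟨u, w, Δ, T, by linarith⟩

/-- A move along a path of arcs stays within the admissible allocations. -/
theorem IsAdmissible.sub_exchange (hv : ∀ i, IsBinaryAdditive (v i)) {x E : Fin n → Fin m → ℝ}
    (hx : IsAdmissible v x) (hcol : ∀ o, ∑ i, E i o = 0) {δ : ℝ} (hδ : 0 < δ)
    (hle : ∀ i o, 0 ≤ x i o - δ * E i o) (hw : ∀ i o, E i o < 0 → v i {o} = 1) :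
    IsAdmissible v fun i o => x i o - δ * E i o := by
  rw [isAdmissible_iff hv] at hx ⊢
  refine ⟨hle, fun i o h => ?_, fun o ho => ?_⟩
  · by_cases hE : E i o < 0
    · exact hw i o hE
    · exact hx.2.1 i o (by nlinarith [mul_nonneg hδ.le (not_lt.1 hE)])
  · rw [Finset.sum_sub_distrib, ← Finset.mul_sum, hcol, mul_zero, sub_zero, hx.2.2 o ho]

theorem profile_sub_exchange {x E : Fin n → Fin m → ℝ} (δ : ℝ) (i : Fin n) :
    profile (fun i o => x i o - δ * E i o) i = profile x i - δ * ∑ o, E i o := by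
  simp only [profile, Finset.sum_sub_distrib, Finset.mul_sum]

theorem optimalAllocations_subset (hv : ∀ i, IsBinaryAdditive (v i)) {f : (Fin n → ℝ) → ℝ}
    (hf : IsSPDOn (profiles v) f) : optimalAllocations v f ⊆ stableAllocations v := by
  rintro x ⟨hx, hopt⟩
  refine ⟨hx, fun hT => ?_⟩
  obtain ⟨u, w, hreach, hlt⟩ := admitsNarrowingTransfer_iff.1 hT
  have huw : u ≠ w := fun h => hlt.ne (by rw [h])
  obtain ⟨E, hP, hN, hcol, hrow⟩ := hreach.exists_exchange
  -- The index `none` encodes `2 * δ ≤ h_u - h_w`, which keeps both new loads strictly between the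
  -- old ones; the other indices keep the entries nonnegative.
  obtain ⟨δ, hδ, hle, -⟩ := exists_max_step (γ := Option (Fin n × Fin m))
    (a := fun c => c.elim 2 fun c => E c.1 c.2)
    (b := fun c => c.elim (profile x u - profile x w) fun c => x c.1 c.2)
    (by
      rintro (_ | c) h
      · exact sub_pos.2 hlt
      · exact hP _ _ h)
    ⟨none, two_pos⟩
  have hδ2 : δ * 2 ≤ profile x u - profile x w := hle none two_pos
  have hy : IsAdmissible v fun i o => x i o - δ * E i o := by
    refine hx.sub_exchange hv hcol hδ (fun i o => ?_) hN
    by_cases h : 0 < E i o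
    · exact sub_nonneg.2 (hle (some (i, o)) h)
    · nlinarith [hx.isAllocation.nonneg i o, mul_nonneg hδ.le (neg_nonneg.2 (not_lt.1 h))]
  refine (hf _ ⟨x, hx, rfl⟩ _ ⟨_, hy, rfl⟩ ⟨w, u, hlt, ?_, ?_, ?_⟩).not_ge (hopt _ hy)
  · rw [profile_sub_exchange, hrow, if_neg huw.symm, if_pos rfl]
    constructor <;> linarith
  · rw [profile_sub_exchange, hrow, if_pos rfl, if_neg huw]
    constructor <;> linarith
  · intro i hi hi'
    rw [profile_sub_exchange, hrow, if_neg hi, if_neg hi']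
    ring

/-- Balancing moves lead from `y` to an allocation with the profile of `x`. The induction is on the
number of nonzero entries and nonzero load differences between `y` and `x`. -/
theorem le_of_stable (hv : ∀ i, IsBinaryAdditive (v i)) {f : (Fin n → ℝ) → ℝ}
    (hf : IsSPDOn (profiles v) f) {x : Fin n → Fin m → ℝ} (hx : x ∈ stableAllocations v)
    {y : Fin n → Fin m → ℝ} (hy : IsAdmissible v y) : f (profile x) ≤ f (profile y) := by
  classical
  obtain ⟨hxa, hxs⟩ := hx
  rw [admitsNarrowingTransfer_iff] at hxs
  push Not at hxs
  -- Loads are included as coordinates so that a step overshoots neither an entry nor a load of `x`.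
  let Z : (Fin n → Fin m → ℝ) → (Fin n × Fin m) ⊕ Fin n → ℝ := fun y =>
    Sum.elim (fun c => y c.1 c.2 - x c.1 c.2) (fun i => profile y i - profile x i)
  induction hN : (Finset.univ.filter fun c => Z y c ≠ 0).card using Nat.strong_induction_on
    generalizing y with
  | _ N ih =>
  have hcols := hy.col_sum_eq hv hxa
  have hrs (i : Fin n) : ∑ o, (y i o - x i o) = profile y i - profile x i :=
    Finset.sum_sub_distrib _ _
  by_cases hall : ∀ i, profile y i ≤ profile x i
  · have hsum : ∑ i, profile y i = ∑ i, profile x i := by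
      simp only [profile]
      rw [Finset.sum_comm, Finset.sum_comm (f := fun i o => x i o)]
      exact Finset.sum_congr rfl fun o _ => hcols o
    have := (Finset.sum_eq_sum_iff_of_le fun i (_ : i ∈ Finset.univ) => hall i).1 hsum
    rw [funext fun i => this i (Finset.mem_univ i)]
  push Not at hall
  obtain ⟨u, hu⟩ := hall
  obtain ⟨w, hreach, hw⟩ := exists_reach_neg (z := fun i o => y i o - x i o)
    (fun o => by rw [Finset.sum_sub_distrib, hcols, sub_self]) (u := u)
    (by rw [hrs]; exact sub_pos.2 hu)
  rw [hrs, sub_neg] at hw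
  have hclean := ((isAdmissible_iff hv).1 hy).2.1
  have hclean' := ((isAdmissible_iff hv).1 hxa).2.1
  -- Where `y` exceeds `x`, the agent values the item as `y` is clean; where `x` exceeds `y`, the
  -- agent holds a part of it in `x`. So each arc of the path is an arc of `x` backwards.
  have hback : Reaches v x w u := by
    refine Relation.reflTransGen_swap.1 (Relation.ReflTransGen.mono ?_ _ _ hreach)
    rintro i i' ⟨o, hpos, hneg⟩
    exact ⟨o, by linarith [hy.isAllocation.nonneg i' o],
      hclean i o (by linarith [hxa.isAllocation.nonneg i o])⟩
  have hwu := hxs w u hback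
  have hne : u ≠ w := fun h => by rw [h] at hu; linarith
  obtain ⟨E, hP, hM, hcol, hrow⟩ := hreach.exists_exchange
  obtain ⟨δ, hδ, hnn, hnp, hcard⟩ := exists_conformal_step (Z := Z y)
    (E := Sum.elim (fun c => E c.1 c.2) (fun i => ∑ o, E i o))
    (by
      rintro (c | i) h
      · exact hP _ _ h
      · simp only [Sum.elim_inr, hrow] at h
        have : i = u := by
          by_contra h'
          rw [if_neg h'] at h
          split_ifs at h <;> linarith
        rw [this]
        exact sub_pos.2 hu)
    (by
      rintro (c | i) h
      · exact hM _ _ h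
      · simp only [Sum.elim_inr, hrow] at h
        have : i = w := by
          by_contra h'
          rw [if_neg h'] at h
          split_ifs at h <;> linarith
        rw [this]
        exact sub_neg.2 hw)
    ⟨Sum.inr u, by simp [hrow, hne]⟩
  have hy' : IsAdmissible v fun i o => y i o - δ * E i o := by
    refine hy.sub_exchange hv hcol hδ (fun i o => ?_) fun i o h =>
      hclean' i o (by have := hM i o h; linarith [hy.isAllocation.nonneg i o])
    rcases le_total 0 (y i o - x i o) with h | h
    · have := hnn (Sum.inl (i, o)) h
      simp only [Z, Sum.elim_inl] at this
      linarith [hxa.isAllocation.nonneg i o]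
    · have : ¬ 0 < E i o := fun h' => (hP i o h').not_ge h
      nlinarith [hy.isAllocation.nonneg i o]
  have hZ : ∀ c, Z (fun i o => y i o - δ * E i o) c =
      Z y c - δ * (Sum.elim (fun c => E c.1 c.2) (fun i => ∑ o, E i o) : _ → ℝ) c := by
    rintro (c | i)
    · simp only [Z, Sum.elim_inl]; ring
    · simp only [Z, Sum.elim_inr, profile_sub_exchange]; ring
  refine (ih _ ?_ hy' rfl).trans (hf _ ⟨y, hy, rfl⟩ _ ⟨_, hy', rfl⟩ ⟨w, u, ?_⟩).le
  · simp only [hZ]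
    exact hN ▸ hcard
  -- No overshooting puts the new load of `w` at most at `profile x w` and that of `u` at least at
  -- `profile x u`; with `hwu` both lie strictly between the old loads.
  · have h1 := hnn (Sum.inr u) (sub_nonneg.2 hu.le)
    have h2 := hnp (Sum.inr w) (sub_nonpos.2 hw.le)
    simp only [Z, Sum.elim_inr, hrow, if_true, if_neg hne, if_neg hne.symm] at h1 h2
    refine ⟨by linarith, ?_, ?_, fun i hi hi' => ?_⟩
    · rw [profile_sub_exchange, hrow, if_neg hne.symm, if_pos rfl]
      constructor <;> linarith
    · rw [profile_sub_exchange, hrow, if_pos rfl, if_neg hne]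
      constructor <;> linarith
    · rw [profile_sub_exchange, hrow, if_neg hi, if_neg hi']
      ring

theorem optimalAllocations_eq (hv : ∀ i, IsBinaryAdditive (v i)) {f : (Fin n → ℝ) → ℝ}
    (hf : IsSPDOn (profiles v) f) : optimalAllocations v f = stableAllocations v :=
  (optimalAllocations_subset hv hf).antisymm fun _ hx => ⟨hx.1, fun _ hy => le_of_stable hv hf hx hy⟩

end Admissible

/-! ### Allocations in integral units -/

section Integral

variable {α β : Type*}

/-- `X` gives away all `D` units of every wanted item, to agents who want it. -/
structure IsIntegral [Fintype α] (W : α → β → Prop) (D : ℕ) (X : α → β → ℕ) : Prop where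
  clean : ∀ i o, 0 < X i o → W i o
  full : ∀ i o, W i o → ∑ j, X j o = D

/-- The number of units that an agent holds. -/
def load [Fintype β] (X : α → β → ℕ) (i : α) : ℕ := ∑ o, X i o

/-- Sum of the squares of the loads. -/
def sqLoad [Fintype α] [Fintype β] (X : α → β → ℕ) : ℕ := ∑ i, load X i ^ 2

/-- Reachability along the arcs of `X`. -/
abbrev Leads (W : α → β → Prop) (X : α → β → ℕ) : α → α → Prop :=
  Reach (fun i o => 0 < X i o) W

/-- Along paths, the load decreases by at most `k`. -/
def SpreadLE [Fintype β] (W : α → β → Prop) (X : α → β → ℕ) (k : ℕ) : Prop :=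
  ∀ u w, Leads W X u w → load X u ≤ load X w + k

variable {W : α → β → Prop} {D k : ℕ} {X Y : α → β → ℕ}

theorem IsIntegral.sum_eq [Fintype α] (hX : IsIntegral W D X) (hY : IsIntegral W D Y) (o : β) :
    ∑ i, X i o = ∑ i, Y i o := by
  by_cases ho : ∃ i, W i o
  · obtain ⟨i, hi⟩ := ho
    rw [hX.full i o hi, hY.full i o hi]
  · push Not at ho
    refine Finset.sum_congr rfl fun i _ => ?_
    rw [Nat.eq_zero_of_not_pos fun h => ho i (hX.clean i o h),
      Nat.eq_zero_of_not_pos fun h => ho i (hY.clean i o h)]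

theorem IsIntegral.mul [Fintype α] (hX : IsIntegral W D X) (k : ℕ) :
    IsIntegral W (k * D) fun i o => k * X i o where
  clean i o h := hX.clean i o (Nat.pos_of_mul_pos_left h)
  full i o h := by rw [← Finset.mul_sum, hX.full i o h]

theorem load_mul [Fintype β] (k : ℕ) (i : α) : load (fun i o => k * X i o) i = k * load X i := by
  simp only [load, Finset.mul_sum]

/-- Scaling creates no new arcs and multiplies the loads by `k`. This is the spread with which the
next phase starts. -/
theorem SpreadLE.mul [Fintype β] (h : SpreadLE W X 1) (k : ℕ) :
    SpreadLE W (fun i o => k * X i o) k := by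
  intro u w huw
  have := h u w (Relation.ReflTransGen.mono
    (fun i i' ⟨o, ho, ho'⟩ => ⟨o, Nat.pos_of_mul_pos_left ho, ho'⟩) _ _ huw)
  rw [load_mul, load_mul]
  calc k * load X u ≤ k * (load X w + 1) := Nat.mul_le_mul_left k this
    _ = _ := by ring

theorem SpreadLE.mono [Fintype β] (h : SpreadLE W X k) {l : ℕ} (hkl : k ≤ l) : SpreadLE W X l :=
  fun u w huw => (h u w huw).trans (Nat.add_le_add_left hkl _)

/-- With one unit per item, no load exceeds the number of items. -/
theorem IsIntegral.spreadLE_card [Fintype α] [Fintype β] (hX : IsIntegral W 1 X) : SpreadLE W X (Fintype.card β) := by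
  intro u w _
  refine le_add_left ?_
  calc load X u ≤ ∑ _o : β, 1 := by
        refine Finset.sum_le_sum fun o _ => ?_
        rcases Nat.eq_zero_or_pos (X u o) with h | h
        · rw [h]; exact Nat.zero_le _
        · rw [← hX.full u o (hX.clean u o h)]
          exact Finset.single_le_sum (f := fun i => X i o) (fun _ _ => Nat.zero_le _)
            (Finset.mem_univ u)
    _ = _ := by simp

/-- A zero-sum vector whose negative entries have at least the weights of its positive ones has a
nonpositive weighted sum. -/
theorem sum_mul_nonpos [Fintype α] {p z : α → ℤ} (hz : ∑ i, z i = 0)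
    (h : ∀ i j, 0 < z i → z j < 0 → p i ≤ p j) : ∑ i, p i * z i ≤ 0 := by
  by_cases hneg : ∃ j, z j < 0
  · obtain ⟨j, hj, hmin⟩ := Set.exists_min_image {j | z j < 0} p (Set.toFinite _) hneg
    -- Shifting all weights by the least weight of a negative entry changes nothing, as the sum of
    -- `z` is zero, and makes every term nonpositive.
    have h1 : ∑ i, p i * z i = ∑ i, (p i - p j) * z i := by
      simp only [sub_mul, Finset.sum_sub_distrib, ← Finset.mul_sum, hz, mul_zero, sub_zero]
    rw [h1]
    refine Finset.sum_nonpos fun i _ => ?_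
    rcases lt_trichotomy (z i) 0 with hi | hi | hi
    · exact mul_nonpos_of_nonneg_of_nonpos (sub_nonneg.2 (hmin i hi)) hi.le
    · rw [hi, mul_zero]
    · exact mul_nonpos_of_nonpos_of_nonneg (sub_nonpos.2 (h i j hi hj)) hi.le
  · push Not at hneg
    have := (Finset.sum_eq_zero_iff_of_nonneg fun i (_ : i ∈ Finset.univ) => hneg i).1 hz
    refine (Finset.sum_eq_zero fun i hi => ?_).le
    rw [this i hi, mul_zero]

/-- If the spread of `X` is at most `k`, its sum of squares is almost minimal. -/
theorem IsIntegral.sqLoad_le [Fintype α] [Fintype β] (hX : IsIntegral W D X) (hY : IsIntegral W D Y)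
    (hk : SpreadLE W X k) : sqLoad X ≤ sqLoad Y + Fintype.card α * k ^ 2 := by
  have hmin : ∀ i, ∃ j, Leads W X i j ∧ ∀ l, Leads W X i l → load X j ≤ load X l := fun i =>
    Set.exists_min_image {j | Leads W X i j} (load X) (Set.toFinite _)
      ⟨i, Relation.ReflTransGen.refl⟩
  choose g hg hgmin using hmin
  -- The least load reachable from `i`: a potential that does not decrease along arcs and lies at
  -- most `k` below the load.
  let p : α → ℤ := fun i => load X (g i)
  let d : α → ℤ := fun i => load X i - load Y i
  have h1 : ∑ i, p i * d i ≤ 0 := by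
    have : ∀ i, p i * d i = ∑ o, p i * ((X i o : ℤ) - Y i o) := fun i => by
      simp only [d, load]
      push_cast
      rw [← Finset.sum_sub_distrib, Finset.mul_sum]
    simp only [this]
    rw [Finset.sum_comm]
    refine Finset.sum_nonpos fun o _ => sum_mul_nonpos ?_ fun i j hi hj => ?_
    · rw [Finset.sum_sub_distrib, sub_eq_zero]
      exact_mod_cast hX.sum_eq hY o
    -- Whoever has more of `o` in `X` than in `Y` has an arc to whoever has less, hence no larger
    -- potential.
    · have hreach : Leads W X i j := Relation.ReflTransGen.single
        ⟨o, by omega, hY.clean j o (by omega)⟩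
      exact Int.ofNat_le.2 (hgmin i _ (hreach.trans (hg j)))
  -- With `a`, `b` the loads in `X`, `Y`: `a ^ 2 - b ^ 2 - 2 * p * (a - b) = (a - p) ^ 2 - (b - p) ^
  -- 2`, where `0 ≤ a - p ≤ k`.
  have h2 : ∀ i, ((load X i : ℤ) ^ 2 - (load Y i : ℤ) ^ 2) ≤ 2 * (p i * d i) + (k : ℤ) ^ 2 := by
    intro i
    have ha : (0 : ℤ) ≤ load X i - p i := by
      have := hgmin i i Relation.ReflTransGen.refl
      simp only [p]; omega
    have hb : (load X i : ℤ) - p i ≤ k := by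
      have := hk i _ (hg i)
      simp only [p]; omega
    simp only [d]
    nlinarith [sq_nonneg ((load X i : ℤ) - p i - ((load X i : ℤ) - load Y i))]
  have h3 := Finset.sum_le_sum fun i (_ : i ∈ Finset.univ) => h2 i
  rw [Finset.sum_sub_distrib, Finset.sum_add_distrib, ← Finset.mul_sum] at h3
  simp only [Finset.sum_const, Finset.card_univ, nsmul_eq_mul] at h3
  have h4 : (sqLoad X : ℤ) ≤ sqLoad Y + Fintype.card α * (k : ℤ) ^ 2 := by
    simp only [sqLoad]
    push_cast
    linarith
  exact_mod_cast h4

/-- A set of agents which is closed under the arcs of `X` holds items as a whole only. -/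
theorem IsIntegral.dvd_sum_load [Fintype α] [Fintype β] (hX : IsIntegral W D X) {A : Finset α}
    (hA : ∀ i ∈ A, ∀ j, Leads W X i j → j ∈ A) : D ∣ ∑ i ∈ A, load X i := by
  simp only [load]
  rw [Finset.sum_comm]
  refine Finset.dvd_sum fun o _ => ?_
  -- If a member of `A` holds a unit of `o`, all other holders are her successors and lie in `A` as
  -- well.
  by_cases h : ∃ i ∈ A, 0 < X i o
  · obtain ⟨i, hi, hio⟩ := h
    rw [← hX.full i o (hX.clean i o hio)]
    refine (Finset.sum_subset (Finset.subset_univ A) fun j _ hj => ?_).symm.dvd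
    refine Nat.eq_zero_of_not_pos fun hjo => hj ?_
    exact hA i hi j (Relation.ReflTransGen.single ⟨o, hio, hX.clean j o hjo⟩)
  · push Not at h
    rw [Finset.sum_eq_zero fun i hi => Nat.le_zero.1 (h i hi)]
    exact dvd_zero D

/-- If the unit is fine enough, a spread of one unit does not occur. -/
theorem IsIntegral.spreadLE_zero [Fintype α] [Fintype β] (hX : IsIntegral W D X) (hD : (Fintype.card α).factorial ∣ D)
    (h1 : SpreadLE W X 1) : SpreadLE W X 0 := by
  classical
  intro u w huw
  by_contra! hlt
  have huw1 := h1 u w huw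
  -- `A c` is everything reachable from loads of at least `c`, a closed set. On `A c \ A (c + 1)`
  -- the loads are `c` or `c - 1`, and `u`, `w` show that both occur.
  let A : ℕ → Finset α := fun c => Finset.univ.filter fun j => ∃ i, c ≤ load X i ∧ Leads W X i j
  have hA : ∀ c j, j ∈ A c ↔ ∃ i, c ≤ load X i ∧ Leads W X i j := fun c j => by simp [A]
  have hcl : ∀ c, D ∣ ∑ i ∈ A c, load X i := fun c => hX.dvd_sum_load fun i hi j hij => by
    obtain ⟨l, hl, hli⟩ := (hA c i).1 hi
    exact (hA c j).2 ⟨l, hl, hli.trans hij⟩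
  set c := load X u with hc
  have hsub : A (c + 1) ⊆ A c := fun j hj => by
    obtain ⟨i, hi, hij⟩ := (hA _ j).1 hj
    exact (hA _ j).2 ⟨i, by omega, hij⟩
  have hw' : w ∉ A (c + 1) := fun h => by
    obtain ⟨i, hi, hij⟩ := (hA _ w).1 h
    have := h1 i w hij
    omega
  have hu' : u ∉ A (c + 1) := fun h => by
    obtain ⟨i, hi, hij⟩ := (hA _ u).1 h
    exact hw' ((hA _ w).2 ⟨i, hi, hij.trans huw⟩)
  set S := A c \ A (c + 1) with hS
  have hu : u ∈ S := Finset.mem_sdiff.2 ⟨(hA _ _).2 ⟨u, le_rfl, .refl⟩, hu'⟩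
  have hw : w ∈ S := Finset.mem_sdiff.2 ⟨(hA _ _).2 ⟨u, le_rfl, huw⟩, hw'⟩
  have hle : ∀ i ∈ S, load X i ≤ c := fun i hi => by
    by_contra! h
    exact (Finset.mem_sdiff.1 hi).2 ((hA _ _).2 ⟨i, h, .refl⟩)
  have hge : ∀ i ∈ S, c - 1 ≤ load X i := fun i hi => by
    obtain ⟨j, hj, hji⟩ := (hA _ i).1 (Finset.mem_sdiff.1 hi).1
    have := h1 j i hji
    omega
  -- `S.card` is at most the number of agents, so it divides the factorial and thus `D`, which
  -- divides the load of either closed set.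
  have hdvd : S.card ∣ ∑ i ∈ S, load X i := by
    have h3 : D ∣ ∑ i ∈ S, load X i := by
      have := Finset.sum_sdiff (f := load X) hsub
      exact (Nat.dvd_add_left (hcl (c + 1))).1 (this ▸ hcl c)
    refine (Nat.dvd_factorial (Finset.card_pos.2 ⟨u, hu⟩) (Finset.card_le_univ S)).trans
      (hD.trans h3)
  obtain ⟨a, ha⟩ := hdvd
  have hlt1 : ∑ i ∈ S, load X i < S.card * c := by
    rw [← smul_eq_mul, ← Finset.sum_const]
    exact Finset.sum_lt_sum hle ⟨w, hw, by omega⟩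
  have hlt2 : S.card * (c - 1) < ∑ i ∈ S, load X i := by
    rw [← smul_eq_mul, ← Finset.sum_const]
    exact Finset.sum_lt_sum hge ⟨u, hu, by omega⟩
  rw [ha] at hlt1 hlt2
  have := lt_of_mul_lt_mul_left hlt1 (Nat.zero_le _)
  have := lt_of_mul_lt_mul_left hlt2 (Nat.zero_le _)
  omega

/-- Moving one unit from an agent to another one whose load is smaller by two or more. -/
theorem sqLoad_lt [Fintype α] [Fintype β] [DecidableEq α] {u w : α} (huw : load X w + 2 ≤ load X u)
    (hY : ∀ i, load Y i + (if i = u then 1 else 0) = load X i + (if i = w then 1 else 0)) :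
    sqLoad Y < sqLoad X := by
  have hne : u ≠ w := fun h => by rw [h] at huw; omega
  have h1 : ∀ i, (load Y i : ℤ) ^ 2 = (load X i : ℤ) ^ 2 +
      ((if i = w then 2 * (load X i : ℤ) + 1 else 0) +
        (if i = u then -2 * (load X i : ℤ) + 1 else 0)) := by
    intro i
    have := hY i
    by_cases hu : i = u
    · have hw : i ≠ w := hu ▸ hne
      rw [if_pos hu, if_neg hw] at this
      rw [if_pos hu, if_neg hw]
      have : (load Y i : ℤ) = load X i - 1 := by omega
      rw [this]; ring
    · rw [if_neg hu] at this ⊢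
      by_cases hw : i = w
      · rw [if_pos hw] at this ⊢
        have : (load Y i : ℤ) = load X i + 1 := by omega
        rw [this]; ring
      · rw [if_neg hw] at this ⊢
        have : (load Y i : ℤ) = load X i := by omega
        rw [this]; ring
  -- The change is `2 * (load X w - load X u) + 2`, at most `-2`.
  have h2 : (sqLoad Y : ℤ) = sqLoad X + ((2 * (load X w : ℤ) + 1) + (-2 * (load X u : ℤ) + 1)) := by
    simp only [sqLoad]
    push_cast
    simp only [h1, Finset.sum_add_distrib, Finset.sum_ite_eq', Finset.mem_univ, if_true]
  omega

end Integral

/-- A stable allocation from an allocation in integral units. -/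
theorem IsIntegral.mem_stableAllocations {n m : ℕ} {v : Fin n → Finset (Fin m) → ℝ}
    (hv : ∀ i, IsBinaryAdditive (v i)) {D : ℕ} {X : Fin n → Fin m → ℕ}
    (hX : IsIntegral (fun i o => v i {o} = 1) D X) (hD : 0 < D)
    (h0 : SpreadLE (fun i o => v i {o} = 1) X 0) :
    (fun i o => (X i o : ℝ) / D) ∈ stableAllocations v := by
  have hD' : (0 : ℝ) < D := by exact_mod_cast hD
  have hpos : ∀ i o, 0 < (X i o : ℝ) / D ↔ 0 < X i o := fun i o => by
    rw [div_pos_iff_of_pos_right hD', Nat.cast_pos]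
  have hprof : ∀ i, profile (fun i o => (X i o : ℝ) / D) i = load X i / D := fun i => by
    simp only [profile, load, ← Finset.sum_div, Nat.cast_sum]
  refine ⟨(isAdmissible_iff hv).2 ⟨fun i o => by positivity,
    fun i o h => hX.clean i o ((hpos i o).1 h), fun o ⟨i, hi⟩ => ?_⟩, ?_⟩
  · rw [← Finset.sum_div, ← Nat.cast_sum, hX.full i o hi, div_self hD'.ne']
  · rw [admitsNarrowingTransfer_iff]
    rintro ⟨u, w, h, hlt⟩
    have h' := h0 u w (Relation.ReflTransGen.mono
      (fun i i' ⟨o, ho, ho'⟩ => ⟨o, (hpos i o).1 ho, ho'⟩) _ _ h)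
    rw [hprof, hprof, div_lt_div_iff_of_pos_right hD', Nat.cast_lt] at hlt
    omega

/-! ### Reasoning about programs -/

/-- A bound for the number of steps of a program all of whose loops are run through at most `N`
times, as a polynomial in `N`. -/
noncomputable def Program.bound : Program → Polynomial ℕ
  | .skip => 1
  | .assign _ e => Polynomial.C (e.cost + 1)
  | .write _ i j e => Polynomial.C (i.cost + j.cost + e.cost + 1)
  | .seq c₁ c₂ => c₁.bound + c₂.bound
  | .branch e c₁ c₂ => Polynomial.C (e.cost + 1) + c₁.bound + c₂.bound
  | .loop e c => Polynomial.X * (c.bound + Polynomial.C (e.cost + 1)) + Polynomial.C (e.cost + 1)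

/-- Whether a program assigns a value to the variable `a`. -/
def Program.setsVar (a : ℕ) : Program → Bool
  | .skip => false
  | .assign b _ => b == a
  | .write _ _ _ _ => false
  | .seq c₁ c₂ => c₁.setsVar a || c₂.setsVar a
  | .branch _ c₁ c₂ => c₁.setsVar a || c₂.setsVar a
  | .loop _ c => c.setsVar a

/-- Whether a program writes to the array `A`. -/
def Program.setsArr (A : ℕ) : Program → Bool
  | .skip => false
  | .assign _ _ => false
  | .write B _ _ _ => B == A
  | .seq c₁ c₂ => c₁.setsArr A || c₂.setsArr A
  | .branch _ c₁ c₂ => c₁.setsArr A || c₂.setsArr A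
  | .loop _ c => c.setsArr A

/-- The stores `s` and `s'` agree outside the variables and arrays that `c` writes to. -/
structure Frame (c : Program) (s s' : Store) : Prop where
  var : ∀ a, c.setsVar a = false → s'.var a = s.var a
  arr : ∀ A, c.setsArr A = false → s'.arr A = s.arr A

theorem Frame.refl (c : Program) (s : Store) : Frame c s s := ⟨fun _ _ => rfl, fun _ _ => rfl⟩

theorem Frame.trans {c : Program} {s₁ s₂ s₃ : Store} (h₁ : Frame c s₁ s₂) (h₂ : Frame c s₂ s₃) :
    Frame c s₁ s₃ :=
  ⟨fun a h => (h₂.var a h).trans (h₁.var a h), fun A h => (h₂.arr A h).trans (h₁.arr A h)⟩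

theorem Runs.frame {c : Program} {s s' : Store} {t : ℕ} (h : Runs c s s' t) : Frame c s s' := by
  induction h with
  | skip => exact .refl _ _
  | assign s a e =>
    refine ⟨fun b hb => ?_, fun _ _ => rfl⟩
    simp only [Program.setsVar, beq_eq_false_iff_ne] at hb
    exact Function.update_of_ne hb.symm _ _
  | write s A i j e =>
    refine ⟨fun _ _ => rfl, fun B hB => ?_⟩
    simp only [Program.setsArr, beq_eq_false_iff_ne] at hB
    exact Function.update_of_ne hB.symm _ _
  | seq _ _ ih₁ ih₂ =>
    refine ⟨fun a h => ?_, fun A h => ?_⟩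
    · simp only [Program.setsVar, Bool.or_eq_false_iff] at h
      rw [ih₂.var a h.2, ih₁.var a h.1]
    · simp only [Program.setsArr, Bool.or_eq_false_iff] at h
      rw [ih₂.arr A h.2, ih₁.arr A h.1]
  | branch_true _ _ ih =>
    refine ⟨fun a h => ?_, fun A h => ?_⟩
    · simp only [Program.setsVar, Bool.or_eq_false_iff] at h
      exact ih.var a h.1
    · simp only [Program.setsArr, Bool.or_eq_false_iff] at h
      exact ih.arr A h.1
  | branch_false _ _ ih =>
    refine ⟨fun a h => ?_, fun A h => ?_⟩
    · simp only [Program.setsVar, Bool.or_eq_false_iff] at h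
      exact ih.var a h.2
    · simp only [Program.setsArr, Bool.or_eq_false_iff] at h
      exact ih.arr A h.2
  | loop_stop => exact .refl _ _
  | loop_step _ _ _ ih₁ ih₂ =>
    exact ⟨fun a h => (ih₂.var a h).trans (ih₁.var a h),
      fun A h => (ih₂.arr A h).trans (ih₁.arr A h)⟩

/-- Started in `s`, the program `c` halts within the time bound for `N` in a store satisfying `Q`. -/
def Ensures (N : ℕ) (c : Program) (Q : Store → Prop) (s : Store) : Prop :=
  ∃ s' t, Runs c s s' t ∧ t ≤ c.bound.eval N ∧ Q s'

namespace Ensures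

variable {N : ℕ} {Q Q' : Store → Prop} {s : Store} {c c₁ c₂ : Program}

theorem mono (h : Ensures N c Q s) (hQ : ∀ s', Frame c s s' → Q s' → Q' s') :
    Ensures N c Q' s := by
  obtain ⟨s', t, hr, ht, hq⟩ := h
  exact ⟨s', t, hr, ht, hQ s' hr.frame hq⟩

theorem skip (h : Q s) : Ensures N .skip Q s :=
  ⟨s, 1, .skip s, by simp [Program.bound], h⟩

theorem assign {a : ℕ} {e : Expr} (h : Q (s.setVar a (e.eval s))) :
    Ensures N (.assign a e) Q s :=
  ⟨_, _, .assign s a e, by simp [Program.bound], h⟩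

theorem write {A : ℕ} {i j e : Expr} (h : Q (s.setArr A (i.eval s) (j.eval s) (e.eval s))) :
    Ensures N (.write A i j e) Q s :=
  ⟨_, _, .write s A i j e, by simp [Program.bound], h⟩

theorem seq (h : Ensures N c₁ (fun s' => Ensures N c₂ Q s') s) :
    Ensures N (.seq c₁ c₂) Q s := by
  obtain ⟨s₁, t₁, hr₁, ht₁, s₂, t₂, hr₂, ht₂, hq⟩ := h
  refine ⟨s₂, t₁ + t₂, .seq hr₁ hr₂, ?_, hq⟩
  simp only [Program.bound, Polynomial.eval_add]
  omega

theorem branch {e : Expr} (h₁ : e.eval s ≠ 0 → Ensures N c₁ Q s)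
    (h₂ : e.eval s = 0 → Ensures N c₂ Q s) : Ensures N (.branch e c₁ c₂) Q s := by
  by_cases he : e.eval s = 0
  · obtain ⟨s', t, hr, ht, hq⟩ := h₂ he
    refine ⟨s', _, .branch_false he hr, ?_, hq⟩
    simp only [Program.bound, Polynomial.eval_add, Polynomial.eval_C]
    omega
  · obtain ⟨s', t, hr, ht, hq⟩ := h₁ he
    refine ⟨s', _, .branch_true he hr, ?_, hq⟩
    simp only [Program.bound, Polynomial.eval_add, Polynomial.eval_C]
    omega

end Ensures

/-- Run `c` with the variable `a` ranging over all numbers less than the variable `b`. -/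
def Program.forLoop (a b : ℕ) (c : Program) : Program :=
  .seq (.assign a (.const 0))
    (.loop (.sub (.var b) (.var a)) (.seq c (.assign a (.add (.var a) (.const 1)))))

@[simp] theorem Store.setVar_arr (s : Store) (a k : ℕ) : (s.setVar a k).arr = s.arr := rfl

@[simp] theorem Store.setArr_var (s : Store) (A i j k : ℕ) : (s.setArr A i j k).var = s.var := rfl

theorem Store.setVar_var (s : Store) (a k b : ℕ) :
    (s.setVar a k).var b = if b = a then k else s.var b := Function.update_apply _ _ _ _

theorem Store.setArr_arr (s : Store) (A i j k B x y : ℕ) :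
    (s.setArr A i j k).arr B x y = if B = A ∧ x = i ∧ y = j then k else s.arr B x y := by
  simp only [Store.setArr, Function.update_apply]
  by_cases hB : B = A
  · by_cases hx : x = i
    · by_cases hy : y = j <;> simp [hB, hx, hy]
    · simp [hB, hx]
  · simp [hB]

namespace Ensures

variable {N : ℕ} {Q : Store → Prop} {s : Store} {c : Program} {a b : ℕ}

/-- A loop with an invariant. -/
theorem forLoop (I : ℕ → Store → Prop) (hN : s.var b ≤ N) (hab : a ≠ b)
    (ha : c.setsVar a = false) (hb : c.setsVar b = false) (h0 : I 0 (s.setVar a 0))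
    (hstep : ∀ s', Frame (.forLoop a b c) s s' → s'.var a < s.var b → I (s'.var a) s' →
      Ensures N c (fun s'' => I (s'.var a + 1) (s''.setVar a (s'.var a + 1))) s')
    (hQ : ∀ s', I (s.var b) s' → Q s') : Ensures N (.forLoop a b c) Q s := by
  set L : Program :=
    .loop (.sub (.var b) (.var a)) (.seq c (.assign a (.add (.var a) (.const 1)))) with hL
  set F : Program := .forLoop a b c with hF
  have hFv : ∀ x, L.setsVar x = false → x ≠ a → F.setsVar x = false := by
    intro x h h'
    simp only [hF, Program.forLoop, Program.setsVar, Bool.or_eq_false_iff, beq_eq_false_iff_ne]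
    simp only [hL, Program.setsVar, Bool.or_eq_false_iff, beq_eq_false_iff_ne] at h
    exact ⟨h'.symm, h⟩
  have hFb : F.setsVar b = false := by
    simp only [hF, Program.forLoop, Program.setsVar, Bool.or_eq_false_iff, beq_eq_false_iff_ne]
    exact ⟨hab, hb, hab⟩
  -- `d` counts the remaining runs. Each costs `4` for the test and `4` for the increment besides
  -- the body; the final `4` is the failing test.
  have key : ∀ d s', Frame F s s' → s'.var a + d = s.var b → I (s'.var a) s' →
      ∃ s'' t, Runs L s' s'' t ∧ t ≤ d * (c.bound.eval N + 8) + 4 ∧ I (s.var b) s'' := by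
    intro d
    induction d with
    | zero =>
      intro s' hf hd hI
      refine ⟨s', _, Runs.loop_stop ?_, ?_, hd ▸ hI⟩
      · simp only [Expr.eval, hf.var b hFb]; omega
      · simp [Expr.cost]
    | succ d ih =>
      intro s' hf hd hI
      obtain ⟨s₁, t₁, hr, ht, hI₁⟩ := hstep s' hf (by omega) hI
      have hva : s₁.var a = s'.var a := hr.frame.var a ha
      have hr2 := hr.seq (Runs.assign s₁ a (.add (.var a) (.const 1)))
      set s₂ := s₁.setVar a ((Expr.add (.var a) (.const 1)).eval s₁) with hs₂
      have hv2 : s₂.var a = s'.var a + 1 := by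
        rw [hs₂, Store.setVar_var, if_pos rfl]; simp only [Expr.eval, hva]
      have hf2 : Frame F s' s₂ := by
        have h3 := hr2.frame
        refine ⟨fun x hx => ?_, fun A hA => ?_⟩
        · simp only [hF, Program.forLoop, Program.setsVar, Bool.or_eq_false_iff] at hx
          exact h3.var x (by simp only [Program.setsVar, Bool.or_eq_false_iff]; exact hx.2)
        · simp only [hF, Program.forLoop, Program.setsArr, Bool.or_eq_false_iff] at hA
          exact h3.arr A (by simp only [Program.setsArr, Bool.or_eq_false_iff]; exact hA.2)
      obtain ⟨s₃, t₃, hr3, ht3, hI3⟩ := ih s₂ (hf.trans hf2) (by omega) (by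
        rw [hv2, hs₂]
        simpa only [Expr.eval, hva] using hI₁)
      refine ⟨s₃, _, .loop_step ?_ hr2 hr3, ?_, hI3⟩
      · simp only [Expr.eval, hf.var b hFb]; omega
      · simp only [Expr.cost]
        rw [Nat.succ_mul]; omega
  have hf0 : Frame F s (s.setVar a 0) := by
    refine ⟨fun x hx => ?_, fun _ _ => rfl⟩
    rw [Store.setVar_var, if_neg]
    rintro rfl
    simp [hF, Program.forLoop, Program.setsVar] at hx
  obtain ⟨s', t, hr, ht, hI⟩ := key (s.var b) (s.setVar a 0) hf0
    (by rw [Store.setVar_var, if_pos rfl, zero_add])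
    (by rw [Store.setVar_var, if_pos rfl]; exact h0)
  refine ⟨s', _, .seq (.assign s a (.const 0)) hr, ?_, hQ s' hI⟩
  simp only [hF, Program.forLoop, Program.bound, Polynomial.eval_add, Polynomial.eval_mul,
    Polynomial.eval_X, Polynomial.eval_C, Expr.cost]
  have := Nat.mul_le_mul_right (c.bound.eval N + 8) hN
  have h8 : N * (c.bound.eval N + (1 + 1 + 1 + 1) + (1 + 1 + 1 + 1)) = N * (c.bound.eval N + 8) := by
    ring
  omega

/-- A loop whose runs achieve goals that are preserved afterwards. -/
theorem forLoop_goals (I : Store → Prop) (M : Store → Store → Prop) (G : ℕ → Store → Prop)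
    (hN : s.var b ≤ N) (hab : a ≠ b) (ha : c.setsVar a = false) (hb : c.setsVar b = false)
    (hIa : ∀ s' k, I s' → I (s'.setVar a k)) (hMa : ∀ s' s'' k, M s' s'' → M s' (s''.setVar a k))
    (hGa : ∀ j s' k, G j s' → G j (s'.setVar a k))
    (hrefl : ∀ s', M s' s') (htrans : ∀ s₁ s₂ s₃, M s₁ s₂ → M s₂ s₃ → M s₁ s₃)
    (hG : ∀ j s₁ s₂, M s₁ s₂ → G j s₁ → G j s₂) (h0 : I s)
    (hstep : ∀ s', Frame (.forLoop a b c) s s' → s'.var a < s.var b → I s' → M s s' →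
      Ensures N c (fun s'' => I s'' ∧ M s' s'' ∧ G (s'.var a) s'') s')
    (hQ : ∀ s', I s' → M s s' → (∀ j < s.var b, G j s') → Q s') :
    Ensures N (.forLoop a b c) Q s := by
  refine forLoop (fun j s' => I s' ∧ M s s' ∧ ∀ l < j, G l s') hN hab ha hb
    ⟨hIa _ _ h0, hMa _ _ _ (hrefl s), by simp⟩ ?_ fun s' h => hQ s' h.1 h.2.1 h.2.2
  rintro s' hf hlt ⟨hI, hM, hGs⟩
  refine (hstep s' hf hlt hI hM).mono fun s'' _ ⟨h1, h2, h3⟩ =>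
    ⟨hIa _ _ h1, hMa _ _ _ (htrans _ _ _ hM h2), fun l hl => hGa _ _ _ ?_⟩
  rcases Nat.lt_succ_iff_lt_or_eq.1 hl with h | rfl
  · exact hG _ _ _ h2 (hGs l h)
  · exact h3

end Ensures

/-! ### The program

Variables: `0`, `1`: the numbers of agents and of items; `2`: a bound for the number of runs of
each loop; `6`: the number of units per item; `7`: phase; `12`: the agent who may receive a unit;
`17`: the agent who holds the unit that is passed on. Arrays: `1`: the units that the agents hold;
`3`: marks of the agents from whom agent `12` is reachable; `4`, `5`: next agent and item on the
path; `6`: loads. -/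

namespace Program

/-- Give every wanted item to the first agent who wants it. -/
def assignItems : Program :=
  forLoop 3 1 (.seq (.assign 5 (.const 0))
    (forLoop 4 0 (.branch (.var 5) .skip (.branch (.read 0 (.var 4) (.var 3))
      (.seq (.write 1 (.var 4) (.var 3) (.const 1)) (.assign 5 (.const 1))) .skip))))

/-- Refine the units by the factor `k + 1`, where `k` is the value of variable `7`. -/
def refineUnits : Program :=
  .seq (forLoop 13 0 (forLoop 14 1 (.seq (.assign 5 (.read 1 (.var 13) (.var 14)))
      (forLoop 8 7 (.write 1 (.var 13) (.var 14)
        (.add (.read 1 (.var 13) (.var 14)) (.var 5)))))))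
    (.seq (.assign 5 (.var 6)) (forLoop 8 7 (.assign 6 (.add (.var 6) (.var 5)))))

/-- Compute the loads. -/
def computeLoads : Program :=
  forLoop 13 0 (.seq (.write 6 (.var 13) (.const 0) (.const 0))
    (forLoop 14 1 (.write 6 (.var 13) (.const 0)
      (.add (.read 6 (.var 13) (.const 0)) (.read 1 (.var 13) (.var 14))))))

/-- Mark agent `13` if item `14` can be handed from her to agent `16`, who has been marked in an
earlier round. -/
def markAgent : Program :=
  .branch (.sub (.read 3 (.var 16) (.const 0)) (.sub (.var 0) (.var 15)))
    (.branch (.read 3 (.var 13) (.const 0)) .skip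
      (.branch (.read 1 (.var 13) (.var 14))
        (.branch (.read 0 (.var 16) (.var 14))
          (.seq (.write 3 (.var 13) (.const 0) (.sub (.var 0) (.var 15)))
            (.seq (.write 4 (.var 13) (.const 0) (.var 16))
              (.write 5 (.var 13) (.const 0) (.var 14))))
          .skip) .skip)) .skip

/-- One round of marking. -/
def markRound : Program :=
  forLoop 13 0 (forLoop 16 0 (forLoop 14 1 markAgent))

/-- Mark all agents from whom agent `12` is reachable. -/
def markAgents : Program :=
  .seq (forLoop 13 0 (.write 3 (.var 13) (.const 0) (.const 0)))
    (.seq (.write 3 (.var 12) (.const 0) (.add (.var 0) (.const 1))) (forLoop 15 0 markRound))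

/-- Look for a marked agent whose load exceeds that of agent `12` by two or more. -/
def findSource : Program :=
  .seq (.assign 17 (.var 12))
    (forLoop 13 0 (.branch (.read 3 (.var 13) (.const 0))
      (.branch (.sub (.read 6 (.var 13) (.const 0))
          (.add (.read 6 (.var 12) (.const 0)) (.const 1)))
        (.assign 17 (.var 13)) .skip) .skip))

/-- Pass one unit on to the next agent. -/
def passUnit : Program :=
  .branch (.sub (.add (.var 0) (.const 1)) (.read 3 (.var 17) (.const 0)))
    (.seq (.assign 18 (.read 5 (.var 17) (.const 0)))
      (.seq (.write 1 (.var 17) (.var 18) (.sub (.read 1 (.var 17) (.var 18)) (.const 1)))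
        (.seq (.assign 17 (.read 4 (.var 17) (.const 0)))
          (.write 1 (.var 17) (.var 18) (.add (.read 1 (.var 17) (.var 18)) (.const 1))))))
    .skip

/-- Move a unit to agent `12` if this is a narrowing transfer. -/
def improve : Program :=
  .seq computeLoads (.seq markAgents (.seq findSource (forLoop 15 0 passUnit)))

/-- Try to move a unit to each agent. -/
def sweep : Program := forLoop 12 0 improve

/-- Sufficiently many sweeps. -/
def sweeps : Program := forLoop 9 2 (forLoop 10 2 (forLoop 11 2 sweep))

/-- Write the denominators. -/
def writeDenominators : Program :=
  forLoop 13 0 (forLoop 14 1 (.write 2 (.var 13) (.var 14) (.var 6)))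

/-- Compute a stable allocation. -/
def stableAllocation : Program :=
  .seq (.assign 2 (.add (.add (.var 0) (.var 1)) (.const 1)))
    (.seq assignItems (.seq (.assign 6 (.const 1))
      (.seq (forLoop 7 0 (.seq refineUnits sweeps)) writeDenominators)))

end Program

/-! ### Correctness of the bookkeeping routines: loads, denominators, refinement, initial assignment
-/

/-- The units that the agents hold in the store `s`. -/
def units (n m : ℕ) (s : Store) (i : Fin n) (o : Fin m) : ℕ := s.arr 1 i o

/-- The mark of an agent. -/
def mark (s : Store) (i : ℕ) : ℕ := s.arr 3 i 0

/-- The part of the store that never changes. -/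
structure Input {n m : ℕ} (W : Fin n → Fin m → Prop) (s : Store) : Prop where
  agents : s.var 0 = n
  items : s.var 1 = m
  bound : s.var 2 = n + m + 1
  wanted : ∀ (i : Fin n) (o : Fin m), s.arr 0 i o ≠ 0 ↔ W i o

section

variable {n m : ℕ} {W : Fin n → Fin m → Prop} {s s' : Store}

theorem Input.frame (h : Input W s) {c : Program} (hf : Frame c s s')
    (h0 : c.setsVar 0 = false := by decide) (h1 : c.setsVar 1 = false := by decide)
    (h2 : c.setsVar 2 = false := by decide) (hA : c.setsArr 0 = false := by decide) :
    Input W s' := by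
  refine ⟨(hf.var 0 h0).trans h.agents, (hf.var 1 h1).trans h.items,
    (hf.var 2 h2).trans h.bound, ?_⟩
  rw [hf.arr 0 hA]
  exact h.wanted

theorem computeLoads_spec (h : Input W s) : Ensures (n + m + 1) .computeLoads
    (fun s' => ∀ i : Fin n, s'.arr 6 i 0 = load (units n m s') i) s := by
  refine .mono (Q := fun s' => ∀ i < n, s'.arr 6 i 0 = ∑ o ∈ Finset.range m, s.arr 1 i o) ?_ ?_
  · refine .forLoop (fun j s' => ∀ i < j, s'.arr 6 i 0 = ∑ o ∈ Finset.range m, s.arr 1 i o)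
      (by rw [h.agents]; omega) (by decide) (by decide) (by decide) (by simp) ?_
      (fun s' => by rw [h.agents]; exact id)
    intro s₁ hf hlt hI
    have h₁ := h.frame hf
    have hX : s₁.arr 1 = s.arr 1 := hf.arr 1 (by decide)
    refine .seq (.write ?_)
    simp only [Expr.eval]
    refine .forLoop (fun j s' => s'.arr 6 (s₁.var 13) 0 =
        ∑ o ∈ Finset.range j, s.arr 1 (s₁.var 13) o ∧
        ∀ i < s₁.var 13, s'.arr 6 i 0 = ∑ o ∈ Finset.range m, s.arr 1 i o)
      (by simp only [Store.setArr_var]; rw [h₁.items]; omega) (by decide) (by decide) (by decide)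
      ⟨by simp [Store.setArr_arr], fun i hi => ?_⟩ ?_ ?_
    · simp only [Store.setVar_arr, Store.setArr_arr]
      rw [if_neg (by omega)]
      exact hI i hi
    · rintro s₂ hf₂ hlt₂ ⟨ha, hb⟩
      have h13 : s₂.var 13 = s₁.var 13 := hf₂.var 13 (by decide)
      have hX₂ : s₂.arr 1 = s.arr 1 := by
        rw [hf₂.arr 1 (by decide), ← hX]
        funext x y
        simp [Store.setArr_arr]
      refine .write ⟨?_, fun i hi => ?_⟩
      · simp only [Expr.eval, Store.setVar_arr, Store.setArr_arr, h13, true_and, if_true]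
        rw [ha, hX₂, Finset.sum_range_succ]
      · simp only [Expr.eval, Store.setVar_arr, Store.setArr_arr, h13]
        rw [if_neg (by omega)]
        exact hb i hi
    · rintro s₂ ⟨ha, hb⟩ i hi
      simp only [Store.setArr_var, h₁.items] at ha
      rcases Nat.lt_succ_iff_lt_or_eq.1 hi with hi | rfl
      · exact hb i hi
      · exact ha
  · intro s' hf hs i
    rw [hs i i.2, ← hf.arr 1 (by decide), Finset.sum_range]
    rfl

theorem writeDenominators_spec (h : Input W s) : Ensures (n + m + 1) .writeDenominators
    (fun s' => ∀ (i : Fin n) (o : Fin m), s'.arr 2 i o = s.var 6) s := by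
  refine .forLoop (fun j s' => ∀ i < j, ∀ o < m, s'.arr 2 i o = s.var 6)
      (by rw [h.agents]; omega) (by decide) (by decide) (by decide) (by simp) ?_
      (fun s' hs i o => hs i (by rw [h.agents]; exact i.2) o o.2)
  intro s₁ hf hlt hI
  have h₁ := h.frame hf
  refine .forLoop (fun j s' => (∀ i < s₁.var 13, ∀ o < m, s'.arr 2 i o = s.var 6) ∧
    ∀ o < j, s'.arr 2 (s₁.var 13) o = s.var 6) (by rw [h₁.items]; omega) (by decide) (by decide)
    (by decide) ⟨hI, by simp⟩ ?_ ?_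
  · rintro s₂ hf₂ hlt₂ ⟨ha, hb⟩
    have h13 : s₂.var 13 = s₁.var 13 := hf₂.var 13 (by decide)
    have h6 : s₂.var 6 = s.var 6 := (hf₂.var 6 (by decide)).trans (hf.var 6 (by decide))
    refine .write ⟨fun i hi o ho => ?_, fun o ho => ?_⟩
    · simp only [Expr.eval, Store.setVar_arr, Store.setArr_arr, h13]
      rw [if_neg (by omega)]
      exact ha i hi o ho
    · simp only [Expr.eval, Store.setVar_arr, Store.setArr_arr, h13, true_and, h6]
      split_ifs with h'
      · rfl
      · exact hb o (by omega)
  · rintro s₂ ⟨ha, hb⟩ i hi o ho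
    rcases Nat.lt_succ_iff_lt_or_eq.1 hi with hi | rfl
    · exact ha i hi o ho
    · exact hb o (by rw [h₁.items]; exact ho)

theorem refineUnits_spec (h : Input W s) (h7 : s.var 7 ≤ n) : Ensures (n + m + 1) .refineUnits
    (fun s' => s'.var 6 = (s.var 7 + 1) * s.var 6 ∧
      units n m s' = fun i o => (s.var 7 + 1) * units n m s i o) s := by
  refine .seq (.mono (Q := fun s' => ∀ i o, s'.arr 1 i o =
    if i < n ∧ o < m then (s.var 7 + 1) * s.arr 1 i o else s.arr 1 i o) ?_ ?_)
  · refine .forLoop (fun j s' => ∀ i o, s'.arr 1 i o =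
        if i < j ∧ o < m then (s.var 7 + 1) * s.arr 1 i o else s.arr 1 i o)
      (by rw [h.agents]; omega) (by decide) (by decide) (by decide) (by simp) ?_
      (fun s' => by rw [h.agents]; exact id)
    intro s₁ hf hlt hI
    have h₁ := h.frame hf
    refine .forLoop (fun j s' => ∀ i o, s'.arr 1 i o =
        if i = s₁.var 13 ∧ o < j then (s.var 7 + 1) * s₁.arr 1 i o else s₁.arr 1 i o)
      (by rw [h₁.items]; omega) (by decide) (by decide) (by decide) (by simp) ?_ ?_
    · intro s₂ hf₂ hlt₂ hI₂
      refine .seq (.assign ?_)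
      have h13 : s₂.var 13 = s₁.var 13 := hf₂.var 13 (by decide)
      have h7' : s₂.var 7 = s.var 7 := (hf₂.var 7 (by decide)).trans (hf.var 7 (by decide))
      have hcur : s₂.arr 1 (s₁.var 13) (s₂.var 14) = s₁.arr 1 (s₁.var 13) (s₂.var 14) := by
        rw [hI₂, if_neg (by omega)]
      -- Multiplication is repeated addition of the saved value; the cell already contains one copy,
      -- hence the factor `j + 1`.
      refine .forLoop (fun j s' => ∀ i o, s'.arr 1 i o =
          if i = s₁.var 13 ∧ o = s₂.var 14 then (j + 1) * s₁.arr 1 i o else s₂.arr 1 i o)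
        (by rw [Store.setVar_var, if_neg (by decide), h7']; omega) (by decide) (by decide)
        (by decide) ?_ ?_ ?_
      · intro i o
        simp only [Store.setVar_arr]
        split_ifs with hc
        · rw [hc.1, hc.2, zero_add, one_mul, hcur]
        · rfl
      · intro s₃ hf₃ hlt₃ hI₃
        have e13 : s₃.var 13 = s₁.var 13 := (hf₃.var 13 (by decide)).trans
          (by rw [Store.setVar_var, if_neg (by decide), h13])
        have e14 : s₃.var 14 = s₂.var 14 := (hf₃.var 14 (by decide)).trans
          (by rw [Store.setVar_var, if_neg (by decide)])
        have e5 : s₃.var 5 = s₁.arr 1 (s₁.var 13) (s₂.var 14) := (hf₃.var 5 (by decide)).trans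
          (by rw [Store.setVar_var, if_pos rfl]; simp only [Expr.eval, h13, hcur])
        refine .write fun i o => ?_
        simp only [Expr.eval, Store.setVar_arr, Store.setArr_arr, e13, e14, e5, true_and]
        split_ifs with hc
        · rw [hI₃, if_pos ⟨rfl, rfl⟩, hc.1, hc.2]; ring
        · rw [hI₃, if_neg hc]
      · intro s₃ hI₃ i o
        rw [Store.setVar_var, if_neg (by decide), h7'] at hI₃
        simp only [Store.setVar_arr]
        rw [hI₃]
        by_cases hc : i = s₁.var 13 ∧ o = s₂.var 14
        · rw [if_pos hc, if_pos ⟨hc.1, by omega⟩]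
        · rw [if_neg hc, hI₂]
          by_cases hc' : i = s₁.var 13 ∧ o < s₂.var 14
          · rw [if_pos hc', if_pos ⟨hc'.1, by omega⟩]
          · rw [if_neg hc', if_neg (by omega)]
    · intro s₂ hI₂ i o
      rw [h₁.items] at hI₂
      simp only [Store.setVar_arr]
      rw [hI₂]
      by_cases hc : i = s₁.var 13 ∧ o < m
      · rw [if_pos hc, if_pos ⟨by omega, hc.2⟩, hI, if_neg (by omega)]
      · rw [if_neg hc, hI]
        by_cases hc' : i < s₁.var 13 ∧ o < m
        · rw [if_pos hc', if_pos ⟨by omega, hc'.2⟩]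
        · rw [if_neg hc', if_neg (by omega)]
  · intro s₁ hf hs
    have h7' : s₁.var 7 = s.var 7 := hf.var 7 (by decide)
    have h6' : s₁.var 6 = s.var 6 := hf.var 6 (by decide)
    refine .seq (.assign ?_)
    refine .mono (Q := fun s' => s'.var 6 = (s.var 7 + 1) * s.var 6) ?_ ?_
    · refine .forLoop (fun j s' => s'.var 6 = (j + 1) * s.var 6)
        (by rw [Store.setVar_var, if_neg (by decide), h7']; omega) (by decide) (by decide)
        (by decide) ?_ ?_ ?_
      · simp [Store.setVar_var, h6']
      · intro s₂ hf₂ _ hI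
        have h5 : s₂.var 5 = s.var 6 := (hf₂.var 5 (by decide)).trans
          (by rw [Store.setVar_var, if_pos rfl]; exact h6')
        refine .assign ?_
        simp only [Store.setVar_var, Expr.eval, h5, hI]
        simp only [show (6 : ℕ) ≠ 8 by decide, if_true, if_false]
        ring
      · intro s₂ hI
        rw [Store.setVar_var, if_neg (by decide), h7'] at hI
        exact hI
    · intro s₂ hf₂ hs₂
      refine ⟨hs₂, ?_⟩
      funext i o
      simp only [units]
      rw [hf₂.arr 1 (by decide), Store.setVar_arr, hs, if_pos ⟨i.2, o.2⟩]

theorem assignItems_spec (h : Input W s) (h1 : ∀ i o, s.arr 1 i o = 0) :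
    Ensures (n + m + 1) .assignItems (fun s' => IsIntegral W 1 (units n m s')) s := by
  let Done (o : Fin m) (s' : Store) : Prop :=
    (∀ i, 0 < units n m s' i o → W i o) ∧ ∀ i, W i o → ∑ j, units n m s' j o = 1
  refine .forLoop (fun j s' => (∀ o : Fin m, o < j → Done o s') ∧
      ∀ o : Fin m, j ≤ o → ∀ i, units n m s' i o = 0)
    (by rw [h.items]; omega) (by decide) (by decide) (by decide)
    ⟨by simp, fun o _ i => h1 i o⟩ ?_ ?_
  · rintro s₁ hf hlt ⟨ha, hb⟩
    have h₁ := h.frame hf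
    rw [h.items] at hlt
    obtain ⟨o, ho⟩ : ∃ o : Fin m, s₁.var 3 = o := ⟨⟨_, hlt⟩, rfl⟩
    refine .seq (.assign ?_)
    -- Variable `5` flags whether item `o` has been given away; while it is `0`, none of the agents
    -- inspected wants `o`.
    refine .forLoop (fun j s' => (∀ o' : Fin m, o' ≠ o → ∀ i, units n m s' i o' = units n m s₁ i o') ∧
        ((s'.var 5 = 0 ∧ (∀ i, units n m s' i o = 0) ∧ ∀ i : Fin n, i < j → ¬ W i o) ∨
        s'.var 5 = 1 ∧ ∃ i₀, W i₀ o ∧ ∀ i, units n m s' i o = if i = i₀ then 1 else 0))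
      (by rw [Store.setVar_var, if_neg (by decide), h₁.agents]; omega) (by decide) (by decide)
      (by decide) ?_ ?_ ?_
    · refine ⟨fun _ _ _ => rfl, .inl ⟨rfl, fun i => hb o ho.le i, by simp⟩⟩
    · rintro s₂ hf₂ hlt₂ ⟨hc, hd⟩
      have h3 : s₂.var 3 = o := (hf₂.var 3 (by decide)).trans
        (by rw [Store.setVar_var, if_neg (by decide), ho])
      have hW : s₂.arr 0 = s₁.arr 0 := hf₂.arr 0 (by decide)
      rw [Store.setVar_var, if_neg (by decide), h₁.agents] at hlt₂
      obtain ⟨i, hi⟩ : ∃ i : Fin n, s₂.var 4 = i := ⟨⟨_, hlt₂⟩, rfl⟩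
      rw [hi]
      refine .branch (fun h5 => .skip ⟨hc, .inr (hd.resolve_left fun h => h5 h.1)⟩) fun h5 => ?_
      simp only [Expr.eval] at h5
      obtain ⟨-, hz, hn⟩ := hd.resolve_right fun h => by rw [h5] at h; simp at h
      refine .branch (fun hv => ?_) fun hv => .skip ⟨hc, .inl ⟨h5, hz, fun i' hi' => ?_⟩⟩
      · simp only [Expr.eval, h3, hi, hW, h₁.wanted] at hv
        refine .seq (.write (.assign ⟨fun o' ho' i' => ?_, .inr ⟨rfl, i, hv, fun i' => ?_⟩⟩))
        · rw [← hc o' ho' i']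
          simp only [units, Expr.eval, Store.setVar_arr, Store.setArr_arr, h3]
          rw [if_neg]
          simp only [Fin.val_inj]
          tauto
        · have := hz i'
          simp only [units] at this
          simp only [units, Expr.eval, Store.setVar_arr, Store.setArr_arr, h3, hi, this,
            Fin.val_inj, true_and, and_true]
      · simp only [Expr.eval, h3, hi, hW] at hv
        rcases Nat.lt_succ_iff_lt_or_eq.1 hi' with h' | h'
        · exact hn i' (hi ▸ h')
        · rw [Fin.val_inj.1 h', ← h₁.wanted]
          exact not_not.2 hv
    · rintro s₂ ⟨hc, hd⟩
      rw [Store.setVar_var, if_neg (by decide), h₁.agents] at hd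
      have hDone : Done o s₂ := by
        rcases hd with ⟨-, hz, hn⟩ | ⟨-, i₀, hw, hi₀⟩
        · exact ⟨fun i hi => absurd hi (by rw [hz]; exact lt_irrefl 0),
            fun i hi => absurd hi (hn i i.2)⟩
        · refine ⟨fun i hi => ?_, fun i _ => by simp [hi₀]⟩
          rw [hi₀] at hi
          split_ifs at hi with h'
          · rw [h']; exact hw
          · exact absurd hi (lt_irrefl 0)
      refine ⟨fun o' ho' => ?_, fun o' ho' i => ?_⟩
      · by_cases he : o' = o
        · rw [he]; exact hDone
        · have := ha o' (by
            have : (o' : ℕ) ≠ o := fun h => he (Fin.val_inj.1 h)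
            omega)
          simp only [Done, ← hc o' he] at this
          exact this
      · have he : o' ≠ o := by rintro rfl; omega
        exact (hc o' he i).trans (hb o' (by omega) i)
  · rintro s' ⟨ha, -⟩
    rw [h.items] at ha
    exact ⟨fun i o => (ha o o.2).1 i, fun i o => (ha o o.2).2 i⟩

end

/-! ### Backward search from the receiver, and passing a unit along the path found -/

section

variable {n m : ℕ} {W : Fin n → Fin m → Prop} {s s' : Store} {X : Fin n → Fin m → ℕ} {w : Fin n}
  {D : ℕ}

/-- `w` can be reached in at most `k` steps. -/
def Within {α : Type*} (R : α → α → Prop) (w : α) : ℕ → α → Prop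
  | 0, i => i = w
  | k + 1, i => Within R w k i ∨ ∃ i', R i i' ∧ Within R w k i'

theorem Within.mono {α : Type*} {R : α → α → Prop} {w i : α} {k l : ℕ} (hkl : k ≤ l)
    (h : Within R w k i) : Within R w l i := by
  induction hkl with
  | refl => exact h
  | step _ ih => exact .inl ih

/-- A simple path visits at most `n` agents, so `n` rounds of marking reach everyone. -/
theorem within_of_reflTransGen {R : Fin n → Fin n → Prop} {u w : Fin n}
    (h : Relation.ReflTransGen R u w) : Within R w n u := by
  obtain ⟨k, a, h0, hk, hR, hinj⟩ := exists_injOn_path h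
  have hkn : k + 1 ≤ n := by
    have := Finset.card_le_card_of_injOn (s := Finset.range (k + 1)) (t := Finset.univ) a
      (fun _ _ => Finset.mem_coe.2 (Finset.mem_univ _))
      (hinj.mono fun j hj => Nat.lt_succ_iff.1 (Finset.mem_range.1 hj))
    simpa using this
  have key : ∀ j ≤ k, Within R w j (a (k - j)) := by
    intro j
    induction j with
    | zero => intro _; exact hk
    | succ j ih =>
      intro hj
      refine .inr ⟨_, ?_, ih (by omega)⟩
      have := hR (k - (j + 1)) (by omega)
      rwa [show k - (j + 1) + 1 = k - j by omega] at this
  have := key k le_rfl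
  rw [Nat.sub_self, h0] at this
  exact this.mono (by omega)

/-- The marks and pointers describe paths to `w`, along which the marks increase; all marks are at
least `l`. -/
structure Marked (W : Fin n → Fin m → Prop) (X : Fin n → Fin m → ℕ) (w : Fin n) (l : ℕ)
    (s : Store) : Prop where
  target : mark s w = n + 1
  lower : ∀ i : Fin n, mark s i ≠ 0 → l ≤ mark s i
  next : ∀ i : Fin n, i ≠ w → mark s i ≠ 0 → mark s i ≤ n ∧ ∃ (i' : Fin n) (o : Fin m),
    s.arr 4 i 0 = i' ∧ s.arr 5 i 0 = o ∧ 0 < X i o ∧ W i' o ∧ mark s i < mark s i'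

/-- Following the pointers increases the mark, which only at `w` exceeds `n`; so the pointers end at
`w`. -/
theorem Marked.leads {l : ℕ} (h : Marked W X w l s) {i : Fin n} (hi : mark s i ≠ 0) :
    Leads W X i w := by
  induction hd : n + 1 - mark s i using Nat.strong_induction_on generalizing i with
  | _ d ih =>
  by_cases hw : i = w
  · rw [hw]
  · obtain ⟨hle, i', o, -, -, hX, hW, hlt⟩ := h.next i hw hi
    exact .head ⟨o, hX, hW⟩ (ih _ (by omega) (by omega) rfl)

/-- The stores that occur in a round of marking: only the mark `l` is newly given. -/
structure InRound (W : Fin n → Fin m → Prop) (X : Fin n → Fin m → ℕ) (w : Fin n) (l : ℕ)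
    (s₀ s : Store) : Prop where
  marked : Marked W X w l s
  old : ∀ i : Fin n, mark s₀ i ≠ 0 → mark s i = mark s₀ i
  new : ∀ i : Fin n, mark s₀ i = 0 → mark s i ≤ l

/-- Truncated subtraction serves as the test `l < mark`. Marks from earlier rounds pass it, while an
agent marked in the current round has mark `l` and fails; hence each new pointer leads to a strictly
larger mark. -/
theorem markAgent_spec {N l : ℕ} {s₀ : Store} (h : Input W s) (hX : units n m s = X)
    (hl : 0 < l) (hln : l ≤ n) (h15 : n - s.var 15 = l) (hlow : ∀ i : Fin n, mark s₀ i ≠ 0 → l < mark s₀ i)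
    (hs : InRound W X w l s₀ s) {i i' : Fin n} {o : Fin m} (hi : s.var 13 = i) (hi' : s.var 16 = i')
    (ho : s.var 14 = o) : Ensures N .markAgent (fun s' => InRound W X w l s₀ s' ∧
      (∀ i : Fin n, mark s i ≠ 0 → mark s' i ≠ 0) ∧
      (mark s₀ i' ≠ 0 → 0 < X i o → W i' o → mark s' i ≠ 0)) s := by
  have hXo : s.arr 1 i o = X i o := by rw [← hX]; rfl
  refine .branch (fun h1 => .branch (fun h2 => .skip ⟨hs, fun _ => id, fun _ _ _ => ?_⟩)
    fun h2 => .branch (fun h3 => .branch (fun h4 => .seq (.write (.seq (.write (.write ?_)))))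
    fun h4 => .skip ⟨hs, fun _ => id, fun _ _ hW => ?_⟩)
    fun h3 => .skip ⟨hs, fun _ => id, fun _ hX' => ?_⟩)
    fun h1 => .skip ⟨hs, fun _ => id, fun hm => ?_⟩
  · simpa only [mark, Expr.eval, hi] using h2
  · simp only [Expr.eval, hi, hi', ho, h.agents, h15, hXo, Store.setArr_var] at h1 h2 h3 h4 ⊢
    set s₁ := ((s.setArr 3 i 0 l).setArr 4 i 0 i').setArr 5 i 0 o with hs₁
    have hi0 : mark s i = 0 := h2
    have hm : ∀ j : Fin n, mark s₁ j = if j = i then l else mark s j := fun j => by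
      simp [mark, hs₁, Store.setArr_arr, Fin.val_inj]
    have h4' : ∀ j : Fin n, s₁.arr 4 j 0 = if j = i then (i' : ℕ) else s.arr 4 j 0 := fun j => by
      simp [hs₁, Store.setArr_arr, Fin.val_inj]
    have h5' : ∀ j : Fin n, s₁.arr 5 j 0 = if j = i then (o : ℕ) else s.arr 5 j 0 := fun j => by
      simp [hs₁, Store.setArr_arr, Fin.val_inj]
    have hmi' : l < mark s i' := by
      simp only [mark]; omega
    have hW : W i' o := (h.wanted i' o).1 h4
    have hmono : ∀ j : Fin n, mark s j ≠ 0 → mark s₁ j = mark s j := fun j hj => by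
      rw [hm, if_neg]
      rintro rfl
      exact hj hi0
    refine ⟨⟨⟨?_, fun j hj => ?_, fun j hjw hj => ?_⟩, fun j hj => ?_, fun j hj => ?_⟩,
      fun j hj => by rw [hmono j hj]; exact hj, fun _ _ _ => by rw [hm, if_pos rfl]; omega⟩
    · rw [hmono w (by rw [hs.marked.target]; omega)]
      exact hs.marked.target
    · rw [hm] at hj ⊢
      split_ifs at hj ⊢
      · exact le_rfl
      · exact hs.marked.lower j hj
    · by_cases hji : j = i
      · rw [h4', h5', hm, if_pos hji, if_pos hji, if_pos hji]
        refine ⟨hln, i', o, rfl, rfl, ?_, hW, ?_⟩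
        · rw [hji]; omega
        · rw [hmono i' (by omega)]; exact hmi'
      · rw [hm, if_neg hji] at hj
        rw [h4', h5', hm, if_neg hji, if_neg hji, if_neg hji]
        obtain ⟨ha, j', o', hb, hc, hd, he, hf⟩ := hs.marked.next j hjw hj
        exact ⟨ha, j', o', hb, hc, hd, he, by rwa [hmono j' (by omega)]⟩
    · rw [hmono j (by rw [hs.old j hj]; exact hj)]
      exact hs.old j hj
    · rw [hm]
      split_ifs
      · exact le_rfl
      · exact hs.new j hj
  · simp only [Expr.eval, hi', ho] at h4
    exact absurd h4 ((h.wanted i' o).2 hW)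
  · simp only [Expr.eval, hi, ho, hXo] at h3
    omega
  · simp only [Expr.eval, hi', h.agents, h15] at h1
    have := hs.old i' hm
    have := hlow i' hm
    simp only [mark] at *
    omega

theorem markRound_spec {l : ℕ} (h : Input W s) (hX : units n m s = X) (hl : 0 < l) (hln : l ≤ n)
    (h15 : n - s.var 15 = l) (hs : Marked W X w (l + 1) s) : Ensures (n + m + 1) .markRound
    (fun s' => Marked W X w l s' ∧ (∀ i : Fin n, mark s i ≠ 0 → mark s' i ≠ 0) ∧
      ∀ (i i' : Fin n) (o : Fin m), mark s i' ≠ 0 → 0 < X i o → W i' o → mark s' i ≠ 0) s := by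
  let M (s₁ s₂ : Store) : Prop := ∀ i : Fin n, mark s₁ i ≠ 0 → mark s₂ i ≠ 0
  let P (i i' : Fin n) (o : Fin m) (s' : Store) : Prop :=
    mark s i' ≠ 0 → 0 < X i o → W i' o → mark s' i ≠ 0
  have hP : ∀ i i' o s₁ s₂, M s₁ s₂ → P i i' o s₁ → P i i' o s₂ :=
    fun i i' o s₁ s₂ hM hp h1 h2 h3 => hM i (hp h1 h2 h3)
  have hrefl : ∀ s, M s s := fun _ _ => id
  have htrans : ∀ s₁ s₂ s₃, M s₁ s₂ → M s₂ s₃ → M s₁ s₃ := fun _ _ _ h h' i hi => h' i (h i hi)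
  have hset : ∀ s' k x, InRound W X w l s s' → InRound W X w l s (s'.setVar x k) :=
    fun s' k x h => ⟨⟨h.marked.target, h.marked.lower, h.marked.next⟩, h.old, h.new⟩
  refine .forLoop_goals (InRound W X w l s) M
    (fun j s' => ∀ i : Fin n, (i : ℕ) = j → ∀ i' o, P i i' o s')
    (by rw [h.agents]; omega) (by decide) (by decide) (by decide) (fun s' k h => hset s' k _ h)
    (fun _ _ _ h => h) (fun _ _ _ h => h) hrefl htrans
    (fun j s₁ s₂ hM hG i hi i' o => hP _ _ _ _ _ hM (hG i hi i' o))
    ⟨⟨hs.target, fun i hi => by have := hs.lower i hi; omega, hs.next⟩, fun _ _ => rfl,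
      fun _ hi => by rw [hi]; exact Nat.zero_le l⟩ ?_
    (fun s' hI hM hG => ⟨hI.marked, hM, fun i i' o =>
      hG i (by rw [h.agents]; exact i.2) i rfl i' o⟩)
  intro s₁ hf₁ hlt₁ hI₁ _
  have h₁ := h.frame hf₁
  rw [h.agents] at hlt₁
  obtain ⟨i, hi⟩ : ∃ i : Fin n, s₁.var 13 = i := ⟨⟨_, hlt₁⟩, rfl⟩
  refine .forLoop_goals (InRound W X w l s) M
    (fun j s' => ∀ i' : Fin n, (i' : ℕ) = j → ∀ o, P i i' o s')
    (by rw [h₁.agents]; omega) (by decide) (by decide) (by decide) (fun s' k h => hset s' k _ h)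
    (fun _ _ _ h => h) (fun _ _ _ h => h) hrefl htrans
    (fun j s₁ s₂ hM hG i hi o => hP _ _ _ _ _ hM (hG i hi o)) hI₁ ?_ ?_
  · intro s₂ hf₂ hlt₂ hI₂ _
    have h₂ := h₁.frame hf₂
    rw [h₁.agents] at hlt₂
    obtain ⟨i', hi'⟩ : ∃ i : Fin n, s₂.var 16 = i := ⟨⟨_, hlt₂⟩, rfl⟩
    refine .forLoop_goals (InRound W X w l s) M
      (fun j s' => ∀ o : Fin m, (o : ℕ) = j → P i i' o s')
      (by rw [h₂.items]; omega) (by decide) (by decide) (by decide) (fun s' k h => hset s' k _ h)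
      (fun _ _ _ h => h) (fun _ _ _ h => h) hrefl htrans
      (fun j s₁ s₂ hM hG o ho => hP _ _ _ _ _ hM (hG o ho)) hI₂ ?_ ?_
    · intro s₃ hf₃ hlt₃ hI₃ _
      have h₃ := h₂.frame hf₃
      rw [h₂.items] at hlt₃
      obtain ⟨o, ho⟩ : ∃ o : Fin m, s₃.var 14 = o := ⟨⟨_, hlt₃⟩, rfl⟩
      refine (markAgent_spec (i := i) (i' := i') (o := o) h₃ ?_ hl hln ?_
        (fun j hj => hs.lower j hj) hI₃ ?_ ?_ ho).mono
        fun s₄ _ ⟨ha, hb, hc⟩ => ⟨ha, hb, fun o' ho' => ?_⟩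
      · funext x y
        simp only [← hX, units]
        rw [hf₃.arr 1 (by decide), hf₂.arr 1 (by decide), hf₁.arr 1 (by decide)]
      · rw [hf₃.var 15 (by decide), hf₂.var 15 (by decide), hf₁.var 15 (by decide), h15]
      · rw [hf₃.var 13 (by decide), hf₂.var 13 (by decide), hi]
      · rw [hf₃.var 16 (by decide), hi']
      · rw [show o' = o from Fin.val_inj.1 (ho'.trans ho)]
        exact hc
    · intro s' ha hb hc
      refine ⟨ha, hb, fun j hj o => ?_⟩
      rw [show j = i' from Fin.val_inj.1 (hj.trans hi')]
      exact hc o (by rw [h₂.items]; exact o.2) o rfl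
  · intro s' ha hb hc
    refine ⟨ha, hb, fun j hj i' o => ?_⟩
    rw [show j = i from Fin.val_inj.1 (hj.trans hi)]
    exact hc i' (by rw [h₁.agents]; exact i'.2) i' rfl o

theorem markAgents_spec (h : Input W s) (hw : s.var 12 = w) : Ensures (n + m + 1) .markAgents
    (fun s' => Marked W (units n m s) w 1 s' ∧
      ∀ i : Fin n, Leads W (units n m s) i w → mark s' i ≠ 0) s := by
  refine .seq (.mono (Q := fun s' => ∀ i < n, mark s' i = 0) ?_ ?_)
  · refine .forLoop (fun j s' => ∀ i < j, mark s' i = 0) (by rw [h.agents]; omega) (by decide)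
      (by decide) (by decide) (by simp) ?_ (fun s' => by rw [h.agents]; exact id)
    intro s₁ _ _ hI
    refine .write fun i hi => ?_
    simp only [mark, Expr.eval, Store.setVar_arr, Store.setArr_arr]
    split_ifs with hc
    · rfl
    · have : i ≠ s₁.var 13 := fun h => hc (by simp [h])
      exact hI i (by omega)
  · intro s₁ hf₁ hz
    have h₁ := h.frame hf₁
    have hX₁ : s₁.arr 1 = s.arr 1 := hf₁.arr 1 (by decide)
    have hw₁ : s₁.var 12 = w := (hf₁.var 12 (by decide)).trans hw
    refine .seq (.write ?_)
    simp only [Expr.eval, hw₁, h₁.agents]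
    set s₂ := s₁.setArr 3 w 0 (n + 1) with hs₂
    have hm : ∀ j : Fin n, mark s₂ j = if j = w then n + 1 else 0 := fun j => by
      have := hz j j.2
      simp only [mark] at this
      simp [mark, hs₂, Store.setArr_arr, Fin.val_inj, this]
    have hv₂ : s₂.var = s₁.var := rfl
    -- The target has mark `n + 1`, and round `j`, counted from `0`, gives the mark `n - j`. After
    -- `n` rounds the least possible mark is `1`, so `0` always means unmarked.
    refine .forLoop (fun j s' => Marked W (units n m s) w (n + 1 - j) s' ∧
      ∀ i : Fin n, Within (Arc (fun i o => 0 < units n m s i o) W) w j i → mark s' i ≠ 0)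
      (by rw [hv₂, h₁.agents]; omega) (by decide) (by decide) (by decide) ?_ ?_ ?_
    · refine ⟨⟨?_, fun i hi => ?_, fun i hiw hi => ?_⟩, fun i hi => ?_⟩
      · exact (hm w).trans (if_pos rfl)
      · change mark s₂ i ≠ 0 at hi
        change _ ≤ mark s₂ i
        rw [hm] at hi ⊢
        split_ifs at hi ⊢
        · omega
        · exact absurd rfl hi
      · change mark s₂ i ≠ 0 at hi
        rw [hm, if_neg hiw] at hi
        exact absurd rfl hi
      · change mark s₂ i ≠ 0
        rw [hm, if_pos (show i = w from hi)]
        omega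
    · rintro s₃ hf₃ hlt ⟨hM, hR⟩
      have hW₂ : Input W s₂ := ⟨h₁.agents, h₁.items, h₁.bound, fun i o => by
        simpa [hs₂, Store.setArr_arr] using h₁.wanted i o⟩
      have h₃ := hW₂.frame hf₃
      rw [hv₂, h₁.agents] at hlt
      have hX₃ : units n m s₃ = units n m s := by
        funext x y
        simp only [units]
        rw [hf₃.arr 1 (by decide), ← hX₁]
        simp [hs₂, Store.setArr_arr]
      refine (markRound_spec (l := n - s₃.var 15) h₃ hX₃ (by omega) (by omega) rfl
        (by rwa [show n - s₃.var 15 + 1 = n + 1 - s₃.var 15 by omega])).mono ?_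
      rintro s₄ _ ⟨ha, hb, hc⟩
      rw [Nat.add_sub_add_right]
      refine ⟨⟨ha.target, ha.lower, ha.next⟩, fun i hi => ?_⟩
      rcases hi with hi | ⟨i', ⟨o, hio, hio'⟩, hi'⟩
      · exact hb i (hR i hi)
      · exact hc i i' o (hR i' hi') hio hio'
    · rintro s₃ ⟨ha, hb⟩
      rw [hv₂, h₁.agents] at ha hb
      refine ⟨⟨ha.target, fun i hi => Nat.one_le_iff_ne_zero.2 hi, ha.next⟩, fun i hi =>
        hb i (within_of_reflTransGen hi)⟩

/-- Agent `w` is the default source. It signals that no marked agent is rich enough, and passing a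
unit then does nothing since `w` is already the target. -/
theorem findSource_spec (h : Input W s) (hw : s.var 12 = w) (hmw : mark s w ≠ 0) :
    Ensures (n + m + 1) .findSource
    (fun s' => ∃ u : Fin n, s'.var 17 = u ∧ mark s u ≠ 0 ∧
      ((u = w ∧ ∀ i : Fin n, mark s i ≠ 0 → s.arr 6 i 0 < s.arr 6 w 0 + 2) ∨
        s.arr 6 w 0 + 2 ≤ s.arr 6 u 0)) s := by
  refine .seq (.assign ?_)
  refine .forLoop (fun j s' => ∃ u : Fin n, s'.var 17 = u ∧ mark s u ≠ 0 ∧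
      ((u = w ∧ ∀ i : Fin n, i < j → mark s i ≠ 0 → s.arr 6 i 0 < s.arr 6 w 0 + 2) ∨
        s.arr 6 w 0 + 2 ≤ s.arr 6 u 0))
    (by rw [Store.setVar_var, if_neg (by decide), h.agents]; omega) (by decide) (by decide)
    (by decide) ⟨w, hw, hmw, .inl ⟨rfl, by simp⟩⟩ ?_ ?_
  · rintro s₁ hf hlt ⟨u, hu, hmu, hd⟩
    rw [Store.setVar_var, if_neg (by decide), h.agents] at hlt
    have h3 : s₁.arr 3 = s.arr 3 := hf.arr 3 (by decide)
    have h6 : s₁.arr 6 = s.arr 6 := hf.arr 6 (by decide)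
    have hw₁ : s₁.var 12 = w := (hf.var 12 (by decide)).trans hw
    obtain ⟨i, hi⟩ : ∃ i : Fin n, s₁.var 13 = i := ⟨⟨_, hlt⟩, rfl⟩
    rw [hi] at hd ⊢
    have keep (hk : mark s i ≠ 0 → s.arr 6 i 0 < s.arr 6 w 0 + 2) :
        ∃ u : Fin n, (s₁.setVar 13 (i + 1)).var 17 = u ∧ mark s u ≠ 0 ∧
        ((u = w ∧ ∀ i' : Fin n, (i' : ℕ) < i + 1 → mark s i' ≠ 0 →
          s.arr 6 i' 0 < s.arr 6 w 0 + 2) ∨ s.arr 6 w 0 + 2 ≤ s.arr 6 u 0) := by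
      refine ⟨u, hu, hmu, hd.imp_left fun hd => ⟨hd.1, fun i' hi' => ?_⟩⟩
      rcases Nat.lt_succ_iff_lt_or_eq.1 hi' with h' | h'
      · exact hd.2 i' h'
      · rw [Fin.val_inj.1 h']; exact hk
    refine .branch (fun ha => .branch (fun hb => .assign ?_) fun hb => .skip (keep fun _ => ?_))
      fun ha => .skip (keep fun hk => ?_)
    · simp only [Expr.eval, hi, h3, h6, hw₁] at ha hb
      exact ⟨i, hi, ha, .inr (by omega)⟩
    · simp only [Expr.eval, hi, h6, hw₁] at hb
      omega
    · simp only [Expr.eval, hi, h3] at ha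
      exact absurd ha hk
  · rintro s₁ ⟨u, hu, hmu, hd⟩
    rw [Store.setVar_var, if_neg (by decide), h.agents] at hd
    exact ⟨u, hu, hmu, hd.imp_left fun hd => ⟨hd.1, fun i => hd.2 i i.2⟩⟩

/-- The move is stated additively on both sides, which avoids truncated subtraction and lets the
sums cancel. -/
theorem IsIntegral.move {Y : Fin n → Fin m → ℕ} (hX : IsIntegral W D X) {c c' : Fin n} {o : Fin m}
    (hw : W c' o) (h : ∀ i o', Y i o' + (if i = c ∧ o' = o then 1 else 0) =
      X i o' + (if i = c' ∧ o' = o then 1 else 0)) :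
    IsIntegral W D Y ∧
      ∀ i, load Y i + (if i = c then 1 else 0) = load X i + (if i = c' then 1 else 0) := by
  refine ⟨⟨fun i o' hi => ?_, fun i o' hi => ?_⟩, fun i => ?_⟩
  · have := h i o'
    by_cases hc : i = c' ∧ o' = o
    · rw [hc.1, hc.2]; exact hw
    · rw [if_neg hc] at this
      exact hX.clean i o' (by omega)
  · have := Finset.sum_congr rfl fun i (_ : i ∈ Finset.univ) => h i o'
    simp only [Finset.sum_add_distrib, ite_and, Finset.sum_ite_eq', Finset.mem_univ, if_true] at this
    rw [← hX.full i o' hi]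
    exact Nat.add_right_cancel this
  · have := Finset.sum_congr rfl fun o' (_ : o' ∈ Finset.univ) => h i o'
    simp only [Finset.sum_add_distrib] at this
    have hs (a : Fin n) : ∑ x, (if i = a ∧ x = o then 1 else 0) = if i = a then 1 else 0 := by
      by_cases h : i = a <;> simp [h]
    rwa [hs, hs] at this

theorem passUnit_spec {N : ℕ} {c c' : Fin n} {o : Fin m} (hc : s.var 17 = c)
    (hm : n + 1 - mark s c ≠ 0) (h0 : s.var 0 = n) (hc' : s.arr 4 c 0 = c') (ho : s.arr 5 c 0 = o)
    (hne : c ≠ c') (hpos : 0 < units n m s c o) : Ensures N .passUnit (fun s' => s'.var 17 = c' ∧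
      ∀ i o', units n m s' i o' + (if i = c ∧ o' = o then 1 else 0) =
        units n m s i o' + (if i = c' ∧ o' = o then 1 else 0)) s := by
  have hne' : (c' : ℕ) ≠ c := fun h => hne (Fin.val_inj.1 h).symm
  refine .branch (fun _ => .seq (.assign (.seq (.write (.seq (.assign (.write ?_))))))) fun ha => ?_
  · have hv : ∀ x y, (if x = (c' : ℕ) ∧ y = (o : ℕ) then s.arr 1 c' o + 1
        else if x = (c : ℕ) ∧ y = (o : ℕ) then s.arr 1 c o - 1 else s.arr 1 x y) +
        (if x = (c : ℕ) ∧ y = (o : ℕ) then 1 else 0) =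
        s.arr 1 x y + (if x = (c' : ℕ) ∧ y = (o : ℕ) then 1 else 0) := by
      intro x y
      simp only [units] at hpos
      by_cases h1 : x = c' ∧ y = o
      · rw [if_pos h1, if_pos h1, if_neg (by omega), h1.1, h1.2]
      · rw [if_neg h1, if_neg h1]
        split_ifs with h2
        · rw [h2.1, h2.2]; omega
        · rfl
    refine ⟨by simp [Store.setVar_var, Store.setArr_arr, Expr.eval, hc, hc'], fun i o' => ?_⟩
    have := hv i o'
    simp only [Fin.val_inj] at this
    rw [← show units n m s i o' = s.arr 1 i o' from rfl] at this
    rw [← this]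
    simp [units, Store.setVar_var, Store.setArr_arr, Expr.eval, hc, hc', ho, hne', Fin.val_inj]
  · simp only [Expr.eval, hc, h0] at ha
    exact absurd ha hm

theorem passUnits_spec {u : Fin n} (h : Input W s) (hX : IsIntegral W D (units n m s))
    (hs : Marked W (units n m s) w 1 s) (hu : s.var 17 = u) (hmu : mark s u ≠ 0) :
    Ensures (n + m + 1) (.forLoop 15 0 .passUnit) (fun s' => IsIntegral W D (units n m s') ∧
      (u = w → units n m s' = units n m s) ∧
      ∀ i, load (units n m s') i + (if i = u then 1 else 0) =
        load (units n m s) i + (if i = w then 1 else 0)) s := by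
  -- `c` currently holds the unit in transit. Marks grow along the path, so agents with at least the
  -- mark of `c` have not lost anything yet and the next arc is still usable. After `n` passes the
  -- mark is at least `n + 1`, so `c` is `w`.
  refine .forLoop (fun j s' => IsIntegral W D (units n m s') ∧ ∃ c : Fin n, s'.var 17 = c ∧
    mark s c ≠ 0 ∧ min (j + 1) (n + 1) ≤ mark s c ∧
    (u = w → c = w ∧ units n m s' = units n m s) ∧
    (∀ i, load (units n m s') i + (if i = u then 1 else 0) =
        load (units n m s) i + (if i = c then 1 else 0)) ∧
    ∀ i : Fin n, mark s c ≤ mark s i → ∀ o, units n m s i o ≤ units n m s' i o)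
    (by rw [h.agents]; omega) (by decide) (by decide) (by decide)
    ⟨hX, u, hu, hmu, by omega, fun h => ⟨h, rfl⟩, fun _ => rfl, fun _ _ _ => le_rfl⟩ ?_ ?_
  · rintro s₁ hf hlt ⟨hX₁, c, hc, hmc, hj, hdone, hload, hle⟩
    have h₁ := h.frame hf
    have h3 : s₁.arr 3 = s.arr 3 := hf.arr 3 (by decide)
    have h4 : s₁.arr 4 = s.arr 4 := hf.arr 4 (by decide)
    have h5 : s₁.arr 5 = s.arr 5 := hf.arr 5 (by decide)
    by_cases ha : n < mark s c
    · refine .branch (fun hb => ?_) fun _ => .skip ⟨hX₁, c, hc, hmc, by omega, hdone, hload, hle⟩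
      simp only [Expr.eval, hc, h3, h₁.agents] at hb
      simp only [mark] at ha
      omega
    · have hcw : c ≠ w := by
        rintro rfl
        rw [hs.target] at ha
        omega
      obtain ⟨-, c', o, hc', ho, hXo, hW, hlt'⟩ := hs.next c hcw hmc
      have hcc : c ≠ c' := by rintro rfl; exact lt_irrefl _ hlt'
      refine (passUnit_spec (n := n) (m := m) hc ?_ h₁.agents (by rw [h4, hc']) (by rw [h5, ho]) hcc
        (hXo.trans_le (hle c le_rfl o))).mono fun s₂ _ ⟨hv, hmove⟩ => ?_
      · simp only [mark, h3] at ha ⊢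
        omega
      · obtain ⟨hY, hYl⟩ := hX₁.move hW hmove
        refine ⟨hY, c', hv, by omega, by omega, fun h => absurd (hdone h).1 hcw, fun i => ?_,
          fun i hi o' => ?_⟩
        · have := hload i
          have : load (units n m (s₂.setVar 15 (s₁.var 15 + 1))) i + (if i = c then 1 else 0) =
            load (units n m s₁) i + (if i = c' then 1 else 0) := hYl i
          omega
        · have h1 := hmove i o'
          have h2 := hle i (by omega) o'
          rw [if_neg (fun h => by rw [h.1] at hi; omega)] at h1
          change _ ≤ units n m s₂ i o'
          omega
  · rintro s₁ ⟨hX₁, c, hc, hmc, hj, hdone, hload, -⟩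
    rw [h.agents] at hj
    have : c = w := by
      by_contra hcw
      have := (hs.next c hcw hmc).1
      omega
    rw [this] at hload
    exact ⟨hX₁, fun h => (hdone h).2, hload⟩

end

/-! ### Termination: the sum of squares drops until the spread is at most one -/

section

variable {n m : ℕ} {W : Fin n → Fin m → Prop} {s s' : Store} {X : Fin n → Fin m → ℕ} {w : Fin n}
  {D : ℕ}

theorem improve_spec (h : Input W s) (hX : IsIntegral W D (units n m s)) (hw : s.var 12 = w) :
    Ensures (n + m + 1) .improve (fun s' => IsIntegral W D (units n m s') ∧
      ((units n m s' = units n m s ∧ ∀ u, Leads W (units n m s) u w →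
          load (units n m s) u < load (units n m s) w + 2) ∨
        sqLoad (units n m s') < sqLoad (units n m s) ∧ ¬ SpreadLE W (units n m s) 1)) s := by
  refine .seq ((computeLoads_spec h).mono fun s₁ hf₁ hl => ?_)
  have h₁ := h.frame hf₁
  have e₁ : units n m s₁ = units n m s := by
    funext i o; simp only [units]; rw [hf₁.arr 1 (by decide)]
  have hw₁ : s₁.var 12 = w := (hf₁.var 12 (by decide)).trans hw
  refine .seq ((markAgents_spec h₁ hw₁).mono fun s₂ hf₂ ⟨hM, hR⟩ => ?_)
  have h₂ := h₁.frame hf₂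
  have e₂ : units n m s₂ = units n m s := by
    rw [← e₁]; funext i o; simp only [units]; rw [hf₂.arr 1 (by decide)]
  have hw₂ : s₂.var 12 = w := (hf₂.var 12 (by decide)).trans hw₁
  have hl₂ : ∀ i : Fin n, s₂.arr 6 i 0 = load (units n m s) i := fun i => by
    rw [hf₂.arr 6 (by decide), hl, e₁]
  rw [e₁] at hM hR
  refine .seq ((findSource_spec h₂ hw₂ (by rw [hM.target]; omega)).mono
    fun s₃ hf₃ ⟨u, hu, hmu, hd⟩ => ?_)
  have h₃ := h₂.frame hf₃
  have e₃ : units n m s₃ = units n m s := by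
    rw [← e₂]; funext i o; simp only [units]; rw [hf₃.arr 1 (by decide)]
  have hmark : mark s₃ = mark s₂ := by
    funext i; simp only [mark]; rw [hf₃.arr 3 (by decide)]
  have hM₃ : Marked W (units n m s₃) w 1 s₃ := by
    rw [e₃]
    refine ⟨by rw [hmark]; exact hM.target, by rw [hmark]; exact hM.lower, ?_⟩
    rw [hmark, hf₃.arr 4 (by decide), hf₃.arr 5 (by decide)]
    exact hM.next
  refine (passUnits_spec (D := D) h₃ (by rwa [e₃]) hM₃ hu (by rwa [hmark])).mono
    fun s₄ _ ⟨hY, hsame, hload⟩ => ⟨hY, ?_⟩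
  rw [e₃] at hsame hload
  simp only [hl₂] at hd
  rcases hd with ⟨huw, hall⟩ | hlt
  · exact .inl ⟨hsame huw, fun i hi => hall i (hR i hi)⟩
  · refine .inr ⟨sqLoad_lt hlt hload, fun hS => ?_⟩
    have := hS u w (hM.leads hmu)
    omega

/-- As long as no move occurs, the units are the original ones, so a sweep without moves has checked
every receiver against the same allocation and certifies spread one. One move already shows that the
initial spread was larger. -/
theorem sweep_spec (h : Input W s) (hX : IsIntegral W D (units n m s)) :
    Ensures (n + m + 1) .sweep (fun s' => IsIntegral W D (units n m s') ∧
      ((units n m s' = units n m s ∧ SpreadLE W (units n m s) 1) ∨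
        sqLoad (units n m s') < sqLoad (units n m s) ∧ ¬ SpreadLE W (units n m s) 1)) s := by
  refine .forLoop (fun j s' => IsIntegral W D (units n m s') ∧
      ((units n m s' = units n m s ∧ ∀ w : Fin n, w < j → ∀ u, Leads W (units n m s) u w →
          load (units n m s) u < load (units n m s) w + 2) ∨
        sqLoad (units n m s') < sqLoad (units n m s) ∧ ¬ SpreadLE W (units n m s) 1))
    (by rw [h.agents]; omega) (by decide) (by decide) (by decide)
    ⟨hX, .inl ⟨rfl, by simp⟩⟩ ?_ ?_
  · rintro s₁ hf hlt ⟨hX₁, hd⟩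
    rw [h.agents] at hlt
    obtain ⟨w, hw⟩ : ∃ i : Fin n, s₁.var 12 = i := ⟨⟨_, hlt⟩, rfl⟩
    rw [hw] at hd ⊢
    refine (improve_spec (h.frame hf) hX₁ hw).mono fun s₂ _ ⟨hX₂, hd₂⟩ => ⟨hX₂, ?_⟩
    change (units n m s₂ = _ ∧ _) ∨ (sqLoad (units n m s₂) < _ ∧ _)
    rcases hd with ⟨heq, hall⟩ | ⟨hlt, hS⟩
    · rw [heq] at hd₂
      refine hd₂.imp_left fun hd₂ => ⟨hd₂.1, fun w' hw' u hu => ?_⟩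
      rcases Nat.lt_succ_iff_lt_or_eq.1 hw' with h' | h'
      · exact hall w' h' u hu
      · rw [Fin.val_inj.1 h'] at hu ⊢
        exact hd₂.2 u hu
    · refine .inr ⟨?_, hS⟩
      rcases hd₂ with ⟨heq, -⟩ | ⟨hlt', -⟩
      · rwa [heq]
      · exact hlt'.trans hlt
  · rintro s₁ ⟨hX₁, hd⟩
    refine ⟨hX₁, hd.imp_left fun hd => ⟨hd.1, fun u w huw => ?_⟩⟩
    have := hd.2 w (by rw [h.agents]; exact w.2) u huw
    omega

/-- Either the spread is at most one, or the sum of squares has been decreased by `q` from `F`. -/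
structure Progress (W : Fin n → Fin m → Prop) (D F q : ℕ) (s : Store) : Prop where
  integral : IsIntegral W D (units n m s)
  progress : SpreadLE W (units n m s) 1 ∨ sqLoad (units n m s) + q ≤ F

theorem Progress.sweep_spec {F q : ℕ} (h : Input W s) (hs : Progress W D F q s) :
    Ensures (n + m + 1) .sweep (Progress W D F (q + 1)) s := by
  refine (FairDiv.sweep_spec h hs.integral).mono fun s' _ ⟨hX, hd⟩ => ⟨hX, ?_⟩
  rcases hd with ⟨heq, hS⟩ | ⟨hlt, hS⟩
  · rw [heq]; exact .inl hS
  · exact .inr (by have := hs.progress.resolve_left hS; omega)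

/-- Nesting this lemma multiplies the guaranteed decrease by `n + m + 1` per loop, whatever the body
is. -/
theorem Progress.forLoop_spec {a F q d : ℕ} {c : Program} (h : Input W s)
    (hs : Progress W D F q s) (ha : 2 < a) (hca : c.setsVar a = false) (h0 : c.setsVar 0 = false)
    (h1 : c.setsVar 1 = false) (h2 : c.setsVar 2 = false) (hA : c.setsArr 0 = false)
    (hc : ∀ {s q}, Input W s → Progress W D F q s →
      Ensures (n + m + 1) c (Progress W D F (q + d)) s) :
    Ensures (n + m + 1) (.forLoop a 2 c) (Progress W D F (q + (n + m + 1) * d)) s := by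
  refine .forLoop (fun j => Progress W D F (q + j * d)) (by rw [h.bound]) (by omega) hca h2
    ⟨hs.integral, by rw [zero_mul, add_zero]; exact hs.progress⟩ ?_ (fun s' => by rw [h.bound]; exact id)
  intro s₁ hf hlt hP
  have hf' : ∀ x, x < 3 → c.setsVar x = false → (Program.forLoop a 2 c).setsVar x = false := by
    intro x hx hx'
    have : a ≠ x := by omega
    simp [Program.forLoop, Program.setsVar, hx', this]
  refine (hc (h.frame hf (hf' 0 (by omega) h0) (hf' 1 (by omega) h1) (hf' 2 (by omega) h2)
    (by simp only [Program.forLoop, Program.setsArr, hA, Bool.or_false])) hP).mono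
    fun s₂ _ hs₂ => ?_
  have : q + s₁.var a * d + d = q + (s₁.var a + 1) * d := by ring
  rw [this] at hs₂
  exact ⟨hs₂.integral, hs₂.progress⟩

theorem sweeps_spec (h : Input W s) (hX : IsIntegral W D (units n m s))
    (hS : SpreadLE W (units n m s) (n + m + 1)) : Ensures (n + m + 1) .sweeps (fun s' =>
      IsIntegral W D (units n m s') ∧ SpreadLE W (units n m s') 1) s := by
  have h0 : Progress W D (sqLoad (units n m s)) 0 s := ⟨hX, .inr le_rfl⟩
  refine (h0.forLoop_spec h (by decide) (by decide) (by decide) (by decide) (by decide)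
    (by decide) fun h' hP => hP.forLoop_spec h' (by decide) (by decide) (by decide) (by decide)
      (by decide) (by decide) fun h'' hP' => hP'.forLoop_spec h'' (by decide) (by decide)
      (by decide) (by decide) (by decide) (by decide) fun h₃ hP₃ => hP₃.sweep_spec h₃).mono
    fun s' _ hP => ⟨hP.integral, hP.progress.resolve_right fun hle => ?_⟩
  -- Otherwise the sum of squares fell by `(n + m + 1) ^ 3`, yet it started at most `n * (n + m + 1)
  -- ^ 2` above that of any other allocation.
  have := hX.sqLoad_le hP.integral hS
  rw [Fintype.card_fin] at this
  have : n * (n + m + 1) ^ 2 < (n + m + 1) * ((n + m + 1) * ((n + m + 1) * 1)) := by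
    nlinarith [Nat.mul_lt_mul_of_pos_right (show n < n + m + 1 by omega)
      (show 0 < (n + m + 1) ^ 2 by positivity)]
  omega

theorem stableAllocation_spec (h0 : s.var 0 = n) (h1 : s.var 1 = m)
    (hW : ∀ (i : Fin n) (o : Fin m), s.arr 0 i o ≠ 0 ↔ W i o) (hX : ∀ i o, s.arr 1 i o = 0) :
    Ensures (n + m + 1) .stableAllocation (fun s' => IsIntegral W n.factorial (units n m s') ∧
      SpreadLE W (units n m s') 1 ∧
      ∀ (i : Fin n) (o : Fin m), s'.arr 2 i o = n.factorial) s := by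
  refine .seq (.assign ?_)
  have h : Input W (s.setVar 2 ((Expr.add (.add (.var 0) (.var 1)) (.const 1)).eval s)) :=
    ⟨h0, h1, by simp [Store.setVar_var, Expr.eval, h0, h1], hW⟩
  refine .seq ((assignItems_spec h hX).mono fun s₁ hf₁ hX₁ => ?_)
  have h₁ := h.frame hf₁
  refine .seq (.assign (.seq ?_))
  have h₂ : Input W (s₁.setVar 6 ((Expr.const 1).eval s₁)) :=
    ⟨h₁.agents, h₁.items, h₁.bound, h₁.wanted⟩
  refine .mono (Q := fun s' => s'.var 6 = n.factorial ∧ IsIntegral W n.factorial (units n m s') ∧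
      SpreadLE W (units n m s') 1) ?_ ?_
  -- Before the first phase only the spread bound `m` is known; that phase refines by the factor
  -- `1`, so the bound `n + m + 1` of `sweeps_spec` still covers it. If `n = 0` no phase runs, and
  -- the claim is vacuous.
  · refine .forLoop (fun j s' => s'.var 6 = j.factorial ∧ IsIntegral W j.factorial (units n m s') ∧
        (SpreadLE W (units n m s') 1 ∨ j = 0 ∧ SpreadLE W (units n m s') m))
      (by rw [h₂.agents]; omega) (by decide) (by decide) (by decide)
      ⟨rfl, hX₁, .inr ⟨rfl, by have := hX₁.spreadLE_card; rwa [Fintype.card_fin] at this⟩⟩ ?_ ?_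
    · rintro s₂ hf₂ hlt ⟨hD, hX₂, hS⟩
      rw [h₂.agents] at hlt
      have h₃ := h₂.frame hf₂
      refine .seq ((refineUnits_spec h₃ hlt.le).mono fun s₃ hf₃ ⟨hD₃, hU₃⟩ => ?_)
      have hX₃ := hX₂.mul (s₂.var 7 + 1)
      rw [← hU₃, ← Nat.factorial_succ] at hX₃
      rw [hD, ← Nat.factorial_succ] at hD₃
      refine (sweeps_spec (h₃.frame hf₃) hX₃ ?_).mono fun s₄ hf₄ ⟨hX₄, hS₄⟩ =>
        ⟨?_, hX₄, .inl hS₄⟩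
      · rcases hS with hS | ⟨hz, hS⟩
        · rw [hU₃]
          exact (hS.mul _).mono (by omega)
        · have : units n m s₃ = units n m s₂ := by
            rw [hU₃, hz]; funext i o; simp
          rw [this]
          exact hS.mono (by omega)
      · rw [Store.setVar_var, if_neg (by decide), hf₄.var 6 (by decide), hD₃]
    · rintro s₂ ⟨hD, hX₂, hS⟩
      rw [h₂.agents] at hD hX₂ hS
      refine ⟨hD, hX₂, hS.elim id fun ⟨hn, _⟩ u => ?_⟩
      exact absurd u.2 (by omega)
  · rintro s₂ hf₂ ⟨hD, hX₂, hS⟩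
    refine (writeDenominators_spec (h₂.frame hf₂)).mono fun s₃ hf₃ hd => ?_
    have : units n m s₃ = units n m s₂ := by
      funext i o; simp only [units]; rw [hf₃.arr 1 (by decide)]
    rw [this]
    exact ⟨hX₂, hS, fun i o => (hd i o).trans hD⟩

end

/-! ### Assembly of the algorithmic statement -/

theorem exists_program_stableAllocation :
    ∃ (c : Program) (P : Polynomial ℕ),
      ∀ (n m : ℕ) (v : Fin n → Finset (Fin m) → ℝ), (∀ i, IsBinaryAdditive (v i)) →
        ∃ (s : Store) (t : ℕ) (x : Fin n → Fin m → ℝ),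
          Runs c (inputStore v) s t ∧ t ≤ P.eval (n + m) ∧
          IsOutput s x ∧ x ∈ stableAllocations v := by
  -- Loops run at most `n + m + 1` times, hence the shift by `1` in the polynomial.
  refine ⟨.stableAllocation, Program.stableAllocation.bound.comp (Polynomial.X + 1),
    fun n m v hv => ?_⟩
  obtain ⟨s, t, hr, ht, hX, hS, hD⟩ := stableAllocation_spec (n := n) (m := m)
    (W := fun i o => v i {o} = 1) (s := inputStore v) rfl rfl
    (fun i o => by simp [inputStore]) (fun i o => by simp [inputStore])
  refine ⟨s, t, fun i o => (units n m s i o : ℝ) / n.factorial, hr, ?_, fun i o => ?_,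
    hX.mem_stableAllocations hv n.factorial_pos (hX.spreadLE_zero (by rw [Fintype.card_fin]) hS)⟩
  · simpa using ht
  · rw [hD]
    exact ⟨n.factorial_pos, rfl⟩

end FairDiv

theorem mainTheorem5 :
    (∀ (n m : ℕ) (v : Fin n → Finset (Fin m) → ℝ), (∀ i, FairDiv.IsBinaryAdditive (v i)) →
      ∀ f : (Fin n → ℝ) → ℝ,
        FairDiv.IsSymmetricOn (FairDiv.profiles v) f →
        FairDiv.IsSPDOn (FairDiv.profiles v) f →
          FairDiv.optimalAllocations v f = FairDiv.stableAllocations v) ∧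
    (∃ (c : FairDiv.Program) (P : Polynomial ℕ),
      ∀ (n m : ℕ) (v : Fin n → Finset (Fin m) → ℝ), (∀ i, FairDiv.IsBinaryAdditive (v i)) →
        ∃ (s : FairDiv.Store) (t : ℕ) (x : Fin n → Fin m → ℝ),
          FairDiv.Runs c (FairDiv.inputStore v) s t ∧ t ≤ P.eval (n + m) ∧
          FairDiv.IsOutput s x ∧ x ∈ FairDiv.stableAllocations v) :=
  ⟨fun _ _ _ hv _ _ hf => FairDiv.optimalAllocations_eq hv hf,
    FairDiv.exists_program_stableAllocation⟩
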